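/- **Setting.** A tangential base point in $\mathbb{C}$ is a pair $\tilde p=(p,v)$ with $p\in\mathbb{C}$ and $v\in\mathbb{C}\setminus\{0\}$. For $M\subseteq\mathbb{C}$, a path from $\tilde p=(p,v)$ to $\tilde q=(q,w)$ on $M$ is a piecewise smooth map $\gamma\colon[0,1]\to\mathbb{C}$ with $\gamma(0)=p$, $\gamma(1)=q$, $\lim_{t\searrow0}\frac{\gamma(t)-p}{t}=v$, $\lim_{t\nearrow1}\frac{\gamma(t)-q}{t-1}=-w$ and $\gamma((0,1))\subseteq M$. Let $D$ be a finite subset of $\mathbb{C}$ with $0\in D$, let $\tilde p,\tilde q$ be tangential base points, and let $\gamma$ be a path from $\tilde p$ to $\tilde q$ on $\mathbb{C}\setminus D$. **Words.** Let $\mathfrak H_D=\mathbb{Q}\langle e_z\mid z\in D\rangle$, with the $\mathbb{Q}$-bilinear shuffle product $⧢$ given by $1⧢w=w⧢1=w$ and $we_z⧢w'e_{z'}=(we_z⧢w')e_{z'}+(w⧢w'e_{z'})e_z$. For a word $e_{a_1}\cdots e_{a_k}$, the integral $$\int_{z<t_1<\cdots<t_k<1-z}\prod_{i=1}^k\frac{d\gamma(t_i)}{\gamma(t_i)-a_i}$$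 has an asymptotic expansion in non-negative integral powers of $z$ and $\log z$ as $z\to+0$; its constant term is denoted by $I_\gamma(\tilde p;e_{a_1}\cdots e_{a_k};\tilde q)$, and $I_\gamma(\tilde p;-;\tilde q)$ is extended $\mathbb{Q}$-linearly to $\mathfrak H_D$. **Trees.** Let $X=(V,E,\mathrm{rt},C)$ be a $D$-colored rooted tree, i.e. a finite tree $(V,E)$ with a root $\mathrm{rt}\in V$ and a map $C\colon V\to D$, and let $\mathbf k\colon E\to\mathbb{Z}_{\ge0}$ be an index on $X$. For $v\neq\mathrm{rt}$ let $p_v$ be the parent of $v$ (the adjacent vertex nearest to the root) and $\mathbf k_v=\mathbf k(\{v,p_v\})$; put $\mathbf k_{\mathrm{rt}}=1$. Assume that $(X;\mathbf k)$ is $\gamma$-harvestable, that is: * $C(\mathrm{rt})\notin\{\gamma(0),\gamma(1)\}$, and every $v$ with $C(v)=\gamma(0)$ has degree greater than $1$; * $\deg(\mathrm{rt})=1$; * $\deg(v)\le2$ if $C(v)\ne0$, and $\deg(v)\neq2$ if $C(v)=0$; * if $\mathbf k_v=0$, then $C(v)=0$ and $C(p_v)\neq0$. Assume moreover that $\mathbf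 k_v>0$ for every vertex $v$ of degree $1$. **The integral of the tree.** Let $\Delta(X;\mathbf k)$ be the set of $(t_v)_{v\in V}\in[0,1]^V$ such that, for every $v\ne\mathrm{rt}$, $t_v<t_{p_v}$ if $\mathbf k_v>0$ and $t_v=t_{p_v}$ if $\mathbf k_v=0$. Put $$I_\gamma(X;\mathbf k)=\int_{\Delta(X;\mathbf k)}\ \prod_{v:\,\mathbf k_v>0}\frac{(\log\gamma(t_{p_v})-\log\gamma(t_v))^{\mathbf k_v-1}}{(\mathbf k_v-1)!}\frac{d\gamma(t_v)}{\gamma(t_v)-C(v)}\ \prod_{v:\,\mathbf k_v=0}\frac{\gamma(t_v)}{\gamma(t_v)-C(v)},$$ where $\log\gamma$ is a continuous branch on $(0,1)$ (for $v=\mathrm{rt}$ the power is $1$), and the integration variables are the $t_v$ with $\mathbf k_v>0$. **The word of the tree.** Define $s_v\in\mathfrak H_D$ for $v\in V$ recursively, from the leaves to the root: if $u_1,\dots,u_m$ are the vertices with parent $v$ (the empty shuffle product being $1$), then $$s_v=\begin{cases}(s_{u_1}⧢\cdots⧢s_{u_m})\,e_0^{\mathbf k_v}&\text{if }\deg(v)\ge3,\\(s_{u_1}⧢\cdots⧢s_{u_m})\,e_{C(v)}e_0^{\mathbf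 k_v-1}&\text{if }\deg(v)\le2,\end{cases}$$ and put $w_{(X;\mathbf k)}=s_{\mathrm{rt}}$. In particular, for a path $v_1,\dots,v_{r+1}=\mathrm{rt}$ one has $w_{(X;\mathbf k)}=e_{C(v_1)}e_0^{\mathbf k_{v_1}-1}\cdots e_{C(v_r)}e_0^{\mathbf k_{v_r}-1}e_{C(\mathrm{rt})}$. **Theorem.** The integral $I_\gamma(X;\mathbf k)$ converges absolutely, the constant term that defines $I_\gamma(\tilde p;u;\tilde q)$ exists for every word $u$ occurring in $w_{(X;\mathbf k)}$, and $$I_\gamma(X;\mathbf k)=I_\gamma(\tilde p;w_{(X;\mathbf k)};\tilde q).$$ -/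

import Mathlib

open MeasureTheory Set Filter Topology
open scoped ContDiff

noncomputable section

namespace TreeIntegral

/-! ### Tangential base points and paths -/

/-- A tangential base point in `ℂ`: a point with a non-zero tangent vector. -/
structure TangentialBasePoint where
  pt : ℂ
  vec : ℂ
  vec_ne_zero : vec ≠ 0

/-- `γ`, restricted to `[0,1]`, is continuous and smooth up to the end points on each closed
subinterval that has no break point in its interior, for some finite set of break points. -/
def PiecewiseSmooth (γ : ℝ → ℂ) : Prop :=
  ContinuousOn γ (Icc 0 1) ∧
    ∃ S : Finset ℝ, ∀ a b : ℝ, 0 ≤ a → a < b → b ≤ 1 → (∀ s ∈ S, s ∉ Ioo a b) →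
      ContDiffOn ℝ ∞ γ (Icc a b)

/-- `γ|_[0,1]` is a path from the tangential base point `p` to the tangential base point `q` on
the subset `M` of `ℂ`. The end points themselves need not lie in `M`. -/
structure IsPathOn (γ : ℝ → ℂ) (p q : TangentialBasePoint) (M : Set ℂ) : Prop where
  piecewiseSmooth : PiecewiseSmooth γ
  source : γ 0 = p.pt
  target : γ 1 = q.pt
  tangent_source : Tendsto (fun t : ℝ => (γ t - p.pt) / (t : ℂ)) (𝓝[>] 0) (𝓝 p.vec)
  tangent_target : Tendsto (fun t : ℝ => (γ t - q.pt) / ((t : ℂ) - 1)) (𝓝[<] 1) (𝓝 (-q.vec))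
  mapsTo : ∀ t ∈ Ioo (0 : ℝ) 1, γ t ∈ M

/-- `L` is a continuous branch of `log γ` on the open interval `(0,1)`. -/
def IsLogAlong (γ : ℝ → ℂ) (L : ℝ → ℂ) : Prop :=
  ContinuousOn L (Ioo 0 1) ∧ ∀ t ∈ Ioo (0 : ℝ) 1, Complex.exp (L t) = γ t

open Classical in
/-- A continuous branch of `log γ` on `(0,1)`. It exists when `γ` is continuous and avoids `0`
there, and then differences of its values do not depend on the choice of the branch. -/
def logAlong (γ : ℝ → ℂ) : ℝ → ℂ :=
  if h : ∃ L, IsLogAlong γ L then h.choose else 0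

/-! ### Words and the shuffle product -/

/-- The non-commutative polynomial ring `ℚ⟨e_z | z ∈ ℂ⟩`, with the words as a basis. -/
abbrev WordAlg : Type := MonoidAlgebra ℚ (FreeMonoid ℂ)

/-- The letter `e_z`. -/
def e (z : ℂ) : WordAlg := MonoidAlgebra.of ℚ (FreeMonoid ℂ) (FreeMonoid.of z)

/-- The shuffle product of two words, each given by the list of its letters read from the last
letter to the first: `1 ⧢ w = w ⧢ 1 = w` and
`w e_a ⧢ w' e_b = (w e_a ⧢ w') e_b + (w ⧢ w' e_b) e_a`. -/
def shuffleRev : List ℂ → List ℂ → WordAlg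
  | [], l => MonoidAlgebra.of ℚ (FreeMonoid ℂ) (FreeMonoid.ofList l.reverse)
  | a :: l, [] => MonoidAlgebra.of ℚ (FreeMonoid ℂ) (FreeMonoid.ofList (a :: l).reverse)
  | a :: l, b :: l' => shuffleRev (a :: l) l' * e b + shuffleRev l (b :: l') * e a
termination_by l l' => l.length + l'.length

/-- The `ℚ`-bilinear shuffle product. -/
def shuffle : WordAlg →ₗ[ℚ] WordAlg →ₗ[ℚ] WordAlg :=
  (MonoidAlgebra.basis (FreeMonoid ℂ) ℚ).constr ℚ fun u =>
    (MonoidAlgebra.basis (FreeMonoid ℂ) ℚ).constr ℚ fun v =>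
      shuffleRev u.toList.reverse v.toList.reverse

/-- The shuffle product of a list of elements (`1` for the empty list). -/
def shuffleList (l : List WordAlg) : WordAlg :=
  l.foldr (fun x y => shuffle x y) 1

/-! ### Regularized iterated integrals along a path -/

/-- The integral of `∏ dγ(tᵢ) / (γ(tᵢ) - aᵢ)` over `z < t₁ < ⋯ < tₖ < 1 - z`. -/
def cutoffIntegral (γ : ℝ → ℂ) (a : List ℂ) (z : ℝ) : ℂ :=
  ∫ t in {t : Fin a.length → ℝ | StrictMono t ∧ ∀ i, t i ∈ Ioo z (1 - z)},
    ∏ i, deriv γ (t i) / (γ (t i) - a.get i)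

/-- `c` is the constant term in the asymptotic expansion of the cut-off integral in powers of
`log z` and `z` as `z → +0`. The terms with a positive power of `z` tend to `0`, so this is the
constant coefficient of the polynomial in `log z` that remains modulo `o(1)`. -/
def HasRegularizedIntegral (γ : ℝ → ℂ) (a : List ℂ) (c : ℂ) : Prop :=
  ∃ P : Polynomial ℂ,
    Tendsto (fun z : ℝ => cutoffIntegral γ a z - P.eval (Real.log z : ℂ)) (𝓝[>] 0) (𝓝 0) ∧
      P.coeff 0 = c

open Classical in
/-- The regularized iterated integral of a word (`0` if there is no asymptotic expansion). -/
def regularizedWord (γ : ℝ → ℂ) (a : List ℂ) : ℂ :=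
  if h : ∃ c, HasRegularizedIntegral γ a c then h.choose else 0

/-- The regularized iterated integral `I_γ(p̃; -; q̃)` as a `ℚ`-linear map; the tangential base
points are determined by `γ`. -/
def regularizedIntegral (γ : ℝ → ℂ) : WordAlg →ₗ[ℚ] ℂ :=
  (MonoidAlgebra.basis (FreeMonoid ℂ) ℚ).constr ℚ fun u => regularizedWord γ u.toList

/-! ### Colored rooted trees -/

/-- A `D`-colored rooted tree with vertex set `V`. -/
structure ColoredTree (D : Set ℂ) (V : Type*) where
  graph : SimpleGraph V
  isTree : graph.IsTree
  root : V
  color : V → ℂ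
  color_mem : ∀ v, color v ∈ D

namespace ColoredTree

variable {D : Set ℂ} {V : Type*} (X : ColoredTree D V)

/-- An index on `X`: a map from the edges to the non-negative integers. -/
abbrev Index : Type _ := X.graph.edgeSet → ℕ

/-- The number of edges at `v`. -/
def deg (v : V) : ℕ := (X.graph.neighborSet v).ncard

theorem exists_parent {v : V} (hv : v ≠ X.root) :
    ∃ w, X.graph.Adj v w ∧ X.graph.dist X.root w + 1 = X.graph.dist X.root v := by
  have hc := X.isTree.1
  obtain ⟨p, hp⟩ := hc.exists_walk_length_eq_dist v X.root
  cases p with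
  | nil => exact absurd rfl hv
  | @cons _ w _ h q =>
    refine ⟨w, h, ?_⟩
    have h1 : X.graph.dist w X.root ≤ q.length := SimpleGraph.dist_le q
    have h2 : X.graph.dist v X.root ≤ X.graph.dist v w + X.graph.dist w X.root :=
      hc.dist_triangle
    have h3 : X.graph.dist v w = 1 := SimpleGraph.dist_eq_one_iff_adj.2 h
    simp only [SimpleGraph.Walk.length_cons] at hp
    rw [SimpleGraph.dist_comm (u := X.root) (v := w),
      SimpleGraph.dist_comm (u := X.root) (v := v)]
    omega

open Classical in
/-- The parent of `v ≠ rt`: the adjacent vertex that is nearest to the root. By convention the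
root is its own parent. -/
def parent (v : V) : V :=
  if h : v ≠ X.root then (X.exists_parent h).choose else v

theorem adj_parent {v : V} (hv : v ≠ X.root) : X.graph.Adj v (X.parent v) := by
  rw [parent, dif_pos hv]
  exact (X.exists_parent hv).choose_spec.1

theorem dist_parent {v : V} (hv : v ≠ X.root) :
    X.graph.dist X.root (X.parent v) + 1 = X.graph.dist X.root v := by
  rw [parent, dif_pos hv]
  exact (X.exists_parent hv).choose_spec.2

open Classical in
/-- The value `k_v` of the index at the edge from `v` to its parent, and `k_rt = 1`. -/
def idx (k : X.Index) (v : V) : ℕ :=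
  if h : v ≠ X.root then k ⟨s(v, X.parent v), X.adj_parent h⟩ else 1

theorem ne_root_of_idx_eq_zero {k : X.Index} {v : V} (h : ¬ 0 < X.idx k v) : v ≠ X.root := by
  rintro rfl
  simp [idx] at h

/-- `X` is `γ`-admissible. -/
def Admissible (γ : ℝ → ℂ) : Prop :=
  (∀ v, X.color v = γ 0 → 1 < X.deg v) ∧ X.color X.root ≠ γ 0 ∧ X.color X.root ≠ γ 1

/-- The pair `(X; k)` is `γ`-harvestable. -/
structure Harvestable (γ : ℝ → ℂ) (k : X.Index) : Prop where
  admissible : X.Admissible γ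
  deg_root : X.deg X.root = 1
  deg_of_color_ne_zero : ∀ v, X.color v ≠ 0 → X.deg v ≤ 2
  deg_of_color_eq_zero : ∀ v, X.color v = 0 → X.deg v ≠ 2
  of_idx_eq_zero : ∀ v, X.idx k v = 0 → X.color v = 0 ∧ X.color (X.parent v) ≠ 0

/-! ### The iterated integral of a colored rooted tree -/

/-- The integration domain `Δ(X; k)`. -/
def domain (k : X.Index) : Set (V → ℝ) :=
  {t | (∀ v, t v ∈ Icc (0 : ℝ) 1) ∧ ∀ v, v ≠ X.root →
    (0 < X.idx k v → t v < t (X.parent v)) ∧ (X.idx k v = 0 → t v = t (X.parent v))}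

/-- The vertices with `k_v > 0`, which carry the actual integration variables. -/
abbrev Free (k : X.Index) : Type _ := {v : V // 0 < X.idx k v}

/-- The nearest vertex `u` with `k_u > 0` on the way from `v` to the root, `v` included. On
`Δ(X; k)` one has `t_v = t_u`. -/
def rep (k : X.Index) (v : V) : X.Free k :=
  if h : 0 < X.idx k v then ⟨v, h⟩ else rep k (X.parent v)
termination_by X.graph.dist X.root v
decreasing_by
  have := X.dist_parent (X.ne_root_of_idx_eq_zero h)
  omega

/-- The point `(t_v)_{v ∈ V}` with the given free coordinates and `t_v = t_{p_v}` whenever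
`k_v = 0`. -/
def extend (k : X.Index) (s : X.Free k → ℝ) : V → ℝ := fun v => s (X.rep k v)

/-- The factor `F_{v,k_v}` at `(γ(t_v))_v`, where `d γ(t_v)` is written as `γ'(t_v) d t_v` and the
logarithm is continued along `γ`. -/
def factor (γ : ℝ → ℂ) (k : X.Index) (t : V → ℝ) (v : V) : ℂ :=
  if 0 < X.idx k v then
    1 / ((X.idx k v - 1).factorial : ℂ) *
      (logAlong γ (t (X.parent v)) - logAlong γ (t v)) ^ (X.idx k v - 1) *
        (deriv γ (t v) / (γ (t v) - X.color v))
  else γ (t v) / (γ (t v) - X.color v)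

variable [Fintype V]

/-- The integrand of `I_γ(X; k)` in the free coordinates. -/
def integrand (γ : ℝ → ℂ) (k : X.Index) (s : X.Free k → ℝ) : ℂ :=
  ∏ v, X.factor γ k (X.extend k s) v

/-- `Δ(X; k)` in the free coordinates. -/
def freeDomain (k : X.Index) : Set (X.Free k → ℝ) := {s | X.extend k s ∈ X.domain k}

/-- The iterated integral `I_γ(X; k)` over `Δ(X; k)`. -/
def treeIntegral (γ : ℝ → ℂ) (k : X.Index) : ℂ :=
  letI := Fintype.ofFinite (X.Free k)
  ∫ s in X.freeDomain k, X.integrand γ k s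

/-- Absolute convergence of the integral `I_γ(X; k)`. -/
def TreeIntegrable (γ : ℝ → ℂ) (k : X.Index) : Prop :=
  letI := Fintype.ofFinite (X.Free k)
  IntegrableOn (X.integrand γ k) (X.freeDomain k)

/-! ### The word of a colored rooted tree -/

open Classical in
/-- The vertices whose parent is `v`. -/
def children (v : V) : Finset V := Finset.univ.filter fun u => u ≠ X.root ∧ X.parent u = v

theorem dist_lt_card (v : V) : X.graph.dist X.root v < Fintype.card V := by
  obtain ⟨p, hp, hl⟩ := X.isTree.1.exists_path_of_dist X.root v
  rw [← hl]
  exact hp.length_lt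

/-- The part of the word of `(X; k)` that comes from the vertex `v` and its descendants. The
words of the children of `v` are shuffled. Then `e_0 ^ k_v` is appended if `v` is branched
(a branched vertex of a harvestable pair has color `0`), and `e_{C(v)} e_0 ^ (k_v - 1)` if it is
not (in a harvestable pair such a `v` has at most one child). For `v ≠ rt` this is the word, with
its last letter removed, of the pair cut off at `v`, i.e. `v` and its descendants with a new root
attached to `v` by an edge of index `k_v`. -/
def subword (k : X.Index) (v : V) : WordAlg :=
  shuffleList ((X.children v).attach.toList.map fun u => subword k u.1) *
    (if 2 < X.deg v then e 0 ^ X.idx k v else e (X.color v) * e 0 ^ (X.idx k v - 1))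
termination_by Fintype.card V - X.graph.dist X.root v
decreasing_by
  obtain ⟨u, hu⟩ := u
  simp only [children, Finset.mem_filter] at hu
  have h1 := X.dist_parent hu.2.1
  rw [hu.2.2] at h1
  have h2 := X.dist_lt_card v
  simp only
  omega

/-- The word `w_{(X; k)}`. With `k_rt = 1` and `deg rt = 1`, it is the word of the pair cut off at
the child of the root, followed by `e_{C(rt)}`. -/
def word (k : X.Index) : WordAlg := X.subword k X.root

end ColoredTree

end TreeIntegral

end

/-! Integrating out the variables of the tree from the leaves to the root turns the integral into an
iterated one-dimensional integral. The partial integral at the vertex `v`, as a function of the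
variable of its parent, is the iterated integral of the word `s_v` along the initial part of the
path: the product over the children is the shuffle product, and the power of
`log γ(t) - log γ(x)` is the iterated integral of the letters `e_0` that follow `e_{C(v)}`. A vertex
with `k_v = 0` has color `0`, so that its factor is `1` and its children may be attached to its
parent.

Absolute convergence and the existence of all integrals come from one class of functions: those
that are, for every `ε > 0`, bounded by a multiple of `t (1 - t)^(-ε)` on `(0, 1)`. If `f` is such
a function and `a` lies off the path, then so is the integral of `f γ' / (γ - a)` from `0` to `t`,
and likewise with a power of the logarithm inserted. The factor `t` makes all integrals converge at
`0` without regularization, provided that no word begins with the letter of `γ(0)`. At the end of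
the path the last letter is not that of `γ(1)`, hence the last integral converges at `1` as well,
and the constant term in `z` is its value.
-/

noncomputable section

namespace TreeIntegral

open Asymptotics

/-! ### Systems of integration variables -/

section SplitCoord

variable {ι α : Type*} [DecidableEq ι] [MeasurableSpace α]

/-- The identification of `α ^ ι` with the product of its factor at `v` and the other factors. -/
def splitCoord (v : ι) : (ι → α) ≃ᵐ α × ({i // i ≠ v} → α) :=
  (MeasurableEquiv.piEquivPiSubtypeProd (fun _ : ι => α) (· = v)).trans
    (MeasurableEquiv.prodCongr (MeasurableEquiv.funUnique _ α) (MeasurableEquiv.refl _))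

theorem splitCoord_symm_self (v : ι) (z : α × ({i // i ≠ v} → α)) :
    (splitCoord v).symm z v = z.1 :=
  congrArg Prod.fst ((splitCoord v).apply_symm_apply z)

theorem splitCoord_symm_of_ne (v : ι) (z : α × ({i // i ≠ v} → α)) (i : {i // i ≠ v}) :
    (splitCoord v).symm z i = z.2 i :=
  congrFun (congrArg Prod.snd ((splitCoord v).apply_symm_apply z)) i

theorem measurePreserving_funUnique_of_fintype {ι α : Type*} [MeasurableSpace α] [Fintype ι]
    [Unique ι] (μ : Measure α) :
    MeasurePreserving (MeasurableEquiv.funUnique ι α) (Measure.pi fun _ => μ) μ := by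
  convert measurePreserving_funUnique μ ι

theorem measurePreserving_splitCoord [Fintype ι] (μ : Measure α) [SigmaFinite μ] (v : ι) :
    MeasurePreserving (splitCoord v) (Measure.pi fun _ : ι => μ)
      (μ.prod (Measure.pi fun _ => μ)) := by
  have hpair := measurePreserving_piEquivPiSubtypeProd (fun _ : ι => μ) (· = v)
  have hunique := @measurePreserving_funUnique_of_fintype {i // i = v} α _ (Subtype.fintype _) _ μ
  exact (hunique.prod (MeasurePreserving.id _)).comp hpair

end SplitCoord

/-- A finite tree of integration variables: every index but the root has a parent of smaller
depth. By convention the root is its own parent. -/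
structure RootedSystem (ι : Type*) where
  root : ι
  par : ι → ι
  depth : ι → ℕ
  par_root : par root = root
  depth_par : ∀ v, v ≠ root → depth (par v) < depth v

namespace RootedSystem

variable {ι α : Type*} (R : RootedSystem ι)

/-- `v` is a leaf: it is not the root, and no index has `v` as its parent. -/
def IsLeaf (v : ι) : Prop := v ≠ R.root ∧ ∀ u, R.par u ≠ v

theorem eq_root_or_exists_isLeaf [Finite ι] : (∀ v, v = R.root) ∨ ∃ v, R.IsLeaf v := by
  by_cases! h : ∀ v, v = R.root
  · exact Or.inl h
  obtain ⟨v, hv, hmax⟩ := Set.exists_max_image {v | v ≠ R.root} R.depth (Set.toFinite _) h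
  refine Or.inr ⟨v, hv, fun u hu => ?_⟩
  have hur : u ≠ R.root := fun hur => hv (by rw [← hu, hur, R.par_root])
  exact (hu ▸ R.depth_par u hur).not_ge (hmax u hur)

/-- The system that remains when the leaf `v` is removed. -/
def erase {v : ι} (hv : R.IsLeaf v) : RootedSystem {i // i ≠ v} where
  root := ⟨R.root, hv.1.symm⟩
  par i := ⟨R.par i, hv.2 i⟩
  depth i := R.depth i
  par_root := Subtype.ext R.par_root
  depth_par i hi := R.depth_par i fun h => hi (Subtype.ext h)

variable [DecidableEq ι]

section Children

variable [Fintype ι]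

/-- The indices whose parent is `v`, the root excluded. -/
def children (v : ι) : Finset ι := {u | u ≠ R.root ∧ R.par u = v}

theorem mem_children {u v : ι} : u ∈ R.children v ↔ u ≠ R.root ∧ R.par u = v := by
  simp [children]

theorem children_eq_empty {v : ι} (hv : ∀ u ≠ R.root, R.par u ≠ v) : R.children v = ∅ :=
  Finset.eq_empty_of_forall_notMem fun u hu =>
    hv u (R.mem_children.1 hu).1 (R.mem_children.1 hu).2

theorem sup_depth_sub_lt {u v : ι} (hu : u ∈ R.children v) :
    Finset.univ.sup R.depth - R.depth u < Finset.univ.sup R.depth - R.depth v := by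
  obtain ⟨hur, rfl⟩ := R.mem_children.1 hu
  have hlt := R.depth_par u hur
  have hle : R.depth u ≤ Finset.univ.sup R.depth := Finset.le_sup (Finset.mem_univ u)
  omega

theorem induction_children {P : ι → Prop} (h : ∀ v, (∀ u ∈ R.children v, P u) → P v) (v : ι) :
    P v :=
  (measure fun v => Finset.univ.sup R.depth - R.depth v).wf.induction v
    fun v ih => h v fun u hu => ih u (R.sup_depth_sub_lt hu)

theorem prod_children_erase {M : Type*} [CommMonoid M] {v : ι} (hv : R.IsLeaf v) (F : ι → M)
    (i : {i // i ≠ v}) :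
    ∏ u ∈ (R.erase hv).children i, F u = ∏ u ∈ (R.children i).erase v, F u := by
  rw [← Finset.prod_subtype_of_mem F fun u hu => (Finset.mem_erase.1 hu).1]
  refine Finset.prod_congr (Finset.ext fun u => ?_) fun u _ => rfl
  simp [mem_children, erase, Subtype.ext_iff, u.2]

end Children

section EraseWeight

variable {M : Type*} [CommMonoid M]

/-- The weights on the system without the leaf `v` that result from `g` when the factor of `v`
is replaced by the function `f` of the variable of the parent of `v`. -/
def eraseWeight (g : ι → α → α → M) (v : ι) (f : α → M) : {i // i ≠ v} → α → α → M :=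
  fun i x t => g i x t * if i.1 = R.par v then f x else 1

variable [Fintype ι] {v : ι} (hv : R.IsLeaf v) (g : ι → α → α → M)

theorem prod_eraseWeight (f : α → M) (s : {i // i ≠ v} → α) :
    ∏ i, R.eraseWeight g v f i (s i) (s ((R.erase hv).par i)) =
      (∏ i : {i // i ≠ v}, g i (s i) (s ((R.erase hv).par i))) * f (s ⟨R.par v, hv.2 v⟩) := by
  simp only [eraseWeight, Finset.prod_mul_distrib]
  congr 1
  rw [Fintype.prod_eq_single ⟨R.par v, hv.2 v⟩ fun i hi => if_neg fun h => hi (Subtype.ext h)]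
  exact if_pos rfl

theorem eraseWeight_mul_prod (F : ι → α → M) (i : {i // i ≠ v}) (x t : α) :
    R.eraseWeight g v (F v) i x t * ∏ u ∈ (R.erase hv).children i, F u x =
      g i x t * ∏ u ∈ R.children i, F u x := by
  rw [R.prod_children_erase hv (F · x), eraseWeight, mul_assoc]
  congr 1
  split_ifs with h
  · exact Finset.mul_prod_erase _ (F · x) (R.mem_children.2 ⟨hv.1, h.symm⟩)
  · rw [one_mul, Finset.erase_eq_of_notMem fun hmem => h (R.mem_children.1 hmem).2.symm]

theorem prod_splitCoord_symm [MeasurableSpace α] (z : α × ({i // i ≠ v} → α)) :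
    ∏ i, g i ((splitCoord v).symm z i) ((splitCoord v).symm z (R.par i)) =
      (∏ i : {i // i ≠ v}, g i (z.2 i) (z.2 ((R.erase hv).par i))) *
        g v z.1 (z.2 ⟨R.par v, hv.2 v⟩) := by
  have hsplit : ∀ i (hi : i ≠ v), (splitCoord v).symm z i = z.2 ⟨i, hi⟩ := fun i hi =>
    splitCoord_symm_of_ne v z ⟨i, hi⟩
  rw [← Finset.prod_erase_mul _ _ (Finset.mem_univ v), splitCoord_symm_self,
    hsplit _ (hv.2 v), Finset.prod_subtype (Finset.univ.erase v) (p := (· ≠ v)) (by simp)]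
  refine congrArg (· * _) (Finset.prod_congr rfl fun i _ => ?_)
  rw [hsplit i i.2, hsplit _ (hv.2 i)]
  rfl

end EraseWeight

variable [MeasurableSpace α] (μ : Measure α) [SigmaFinite μ] [Fintype ι]

section Lebesgue

open scoped ENNReal

theorem lintegral_prod_of_isLeaf {v : ι} (hv : R.IsLeaf v) {g : ι → α → α → ℝ≥0∞}
    (hg : ∀ v, Measurable fun z : α × α => g v z.1 z.2) :
    ∫⁻ s, ∏ i, g i (s i) (s (R.par i)) ∂(Measure.pi fun _ => μ) =
      ∫⁻ s, ∏ i, R.eraseWeight g v (fun t => ∫⁻ x, g v x t ∂μ) i (s i) (s ((R.erase hv).par i))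
        ∂(Measure.pi fun _ => μ) := by
  rw [← (measurePreserving_splitCoord μ v).symm.lintegral_comp_emb
    (splitCoord v).symm.measurableEmbedding]
  simp only [R.prod_splitCoord_symm hv g, R.prod_eraseWeight hv g]
  have hmeas : ∀ i : {i // i ≠ v}, Measurable fun z : α × ({i // i ≠ v} → α) =>
      g i (z.2 i) (z.2 ((R.erase hv).par i)) := fun i =>
    (hg i).comp (by fun_prop : Measurable fun z : α × ({i // i ≠ v} → α) =>
      (z.2 i, z.2 ((R.erase hv).par i)))
  rw [lintegral_prod_symm]
  · refine lintegral_congr fun s => ?_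
    have hgv : Measurable fun x => g v x (s ⟨R.par v, hv.2 v⟩) :=
      (hg v).comp (measurable_id.prodMk measurable_const)
    rw [← lintegral_const_mul _ hgv]
  · refine ((Finset.measurable_prod _ fun i _ => hmeas i).mul ?_).aemeasurable
    exact (hg v).comp (by fun_prop : Measurable fun z : α × ({i // i ≠ v} → α) =>
      (z.1, z.2 ⟨R.par v, hv.2 v⟩))

theorem lintegral_prod {ι : Type*} [Fintype ι] [DecidableEq ι] (R : RootedSystem ι)
    {g : ι → α → α → ℝ≥0∞} {A : ι → α → ℝ≥0∞}
    (hg : ∀ v, Measurable fun z : α × α => g v z.1 z.2)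
    (hA : ∀ v ≠ R.root, ∀ t, A v t = ∫⁻ x, g v x t * ∏ u ∈ R.children v, A u x ∂μ) :
    ∫⁻ s, ∏ v, g v (s v) (s (R.par v)) ∂(Measure.pi fun _ => μ) =
      ∫⁻ x, g R.root x x * ∏ u ∈ R.children R.root, A u x ∂μ := by
  induction h : Fintype.card ι generalizing ι with
  | zero => exact ((Fintype.card_eq_zero_iff.1 h).false R.root).elim
  | succ n ih =>
    obtain hroot | ⟨v, hv⟩ := R.eq_root_or_exists_isLeaf
    · let _ : Unique ι := ⟨⟨R.root⟩, hroot⟩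
      rw [R.children_eq_empty fun u hu => absurd (hroot u) hu,
        ← (measurePreserving_funUnique_of_fintype μ).lintegral_comp_emb
          (MeasurableEquiv.funUnique ι α).measurableEmbedding]
      refine lintegral_congr fun s => ?_
      rw [Fintype.prod_unique, hroot (R.par _), Finset.prod_empty, mul_one]
      rfl
    · have hAv : A v = fun t => ∫⁻ x, g v x t ∂μ := by
        funext t
        simp only [hA v hv.1, R.children_eq_empty fun u _ => hv.2 u, Finset.prod_empty, mul_one]
      rw [R.lintegral_prod_of_isLeaf μ hv hg, ← hAv, ih (R.erase hv) (A := fun i => A i)]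
      · exact lintegral_congr fun x => R.eraseWeight_mul_prod hv g A _ x x
      · refine fun i => (hg i).mul ?_
        split_ifs
        · exact (hAv ▸ Measurable.lintegral_prod_left' (hg v)).comp measurable_fst
        · exact measurable_const
      · intro i hi t
        simp only [R.eraseWeight_mul_prod hv g A i]
        exact hA i (fun h => hi (Subtype.ext h)) t
      · simp [Fintype.card_subtype_compl, h]

/-- The integral over the variables of `v` and its descendants, as a function of the variable of
the parent of `v`. -/
def lintegralBelow (g : ι → α → α → ℝ≥0∞) (v : ι) (t : α) : ℝ≥0∞ :=
  ∫⁻ x, g v x t * ∏ u ∈ (R.children v).attach, lintegralBelow g u.1 x ∂μ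
termination_by Finset.univ.sup R.depth - R.depth v
decreasing_by exact R.sup_depth_sub_lt u.2

omit [SigmaFinite μ] in
theorem lintegralBelow_eq (g : ι → α → α → ℝ≥0∞) (v : ι) (t : α) :
    R.lintegralBelow μ g v t =
      ∫⁻ x, g v x t * ∏ u ∈ R.children v, R.lintegralBelow μ g u x ∂μ := by
  rw [lintegralBelow]
  exact lintegral_congr fun x =>
    congrArg _ (Finset.prod_attach _ fun u => R.lintegralBelow μ g u x)

end Lebesgue

section Bochner

variable {𝕜 : Type*} [RCLike 𝕜]

theorem integrable_prod_splitCoord_symm {v : ι} (hv : R.IsLeaf v) {g : ι → α → α → 𝕜}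
    (hint : Integrable (fun s => ∏ i, g i (s i) (s (R.par i))) (Measure.pi fun _ => μ)) :
    Integrable (fun z : α × ({i // i ≠ v} → α) =>
      (∏ i : {i // i ≠ v}, g i (z.2 i) (z.2 ((R.erase hv).par i))) *
        g v z.1 (z.2 ⟨R.par v, hv.2 v⟩)) (μ.prod (Measure.pi fun _ => μ)) := by
  have h := ((measurePreserving_splitCoord μ v).symm.integrable_comp_emb
    (splitCoord v).symm.measurableEmbedding).2 hint
  simpa only [Function.comp_def, R.prod_splitCoord_symm hv g] using h

theorem integrable_prod_eraseWeight {v : ι} (hv : R.IsLeaf v) {g : ι → α → α → 𝕜}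
    (hint : Integrable (fun s => ∏ i, g i (s i) (s (R.par i))) (Measure.pi fun _ => μ)) :
    Integrable (fun s => ∏ i, R.eraseWeight g v (fun t => ∫ x, g v x t ∂μ) i (s i)
      (s ((R.erase hv).par i))) (Measure.pi fun _ => μ) := by
  simpa only [R.prod_eraseWeight hv g, integral_const_mul] using
    (R.integrable_prod_splitCoord_symm μ hv hint).integral_prod_right

theorem integral_prod_of_isLeaf {v : ι} (hv : R.IsLeaf v) {g : ι → α → α → 𝕜}
    (hint : Integrable (fun s => ∏ i, g i (s i) (s (R.par i))) (Measure.pi fun _ => μ)) :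
    ∫ s, ∏ i, g i (s i) (s (R.par i)) ∂(Measure.pi fun _ => μ) =
      ∫ s, ∏ i, R.eraseWeight g v (fun t => ∫ x, g v x t ∂μ) i (s i) (s ((R.erase hv).par i))
        ∂(Measure.pi fun _ => μ) := by
  rw [← (measurePreserving_splitCoord μ v).symm.integral_comp
    (splitCoord v).symm.measurableEmbedding]
  simp only [R.prod_splitCoord_symm hv g, R.prod_eraseWeight hv g]
  rw [integral_prod_symm _ (R.integrable_prod_splitCoord_symm μ hv hint)]
  simp only [integral_const_mul]

omit [MeasurableSpace α] in
theorem prod_eraseWeight_congr {v : ι} (hv : R.IsLeaf v) {g : ι → α → α → 𝕜} {U : Set α}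
    (hg : ∀ v, ∀ x ∉ U, ∀ t, g v x t = 0) {f₁ f₂ : α → 𝕜} (hf : EqOn f₁ f₂ U)
    (s : {i // i ≠ v} → α) :
    ∏ i, R.eraseWeight g v f₁ i (s i) (s ((R.erase hv).par i)) =
      ∏ i, R.eraseWeight g v f₂ i (s i) (s ((R.erase hv).par i)) := by
  by_cases hs : s ⟨R.par v, hv.2 v⟩ ∈ U
  · rw [R.prod_eraseWeight hv g, R.prod_eraseWeight hv g, hf hs]
  · have hzero : ∏ i : {i // i ≠ v}, g i (s i) (s ((R.erase hv).par i)) = 0 :=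
      Finset.prod_eq_zero (Finset.mem_univ ⟨R.par v, hv.2 v⟩) (hg _ _ hs _)
    rw [R.prod_eraseWeight hv g, R.prod_eraseWeight hv g, hzero, zero_mul, zero_mul]

theorem integral_prod {ι : Type*} [Fintype ι] [DecidableEq ι] (R : RootedSystem ι)
    {g : ι → α → α → 𝕜} {F : ι → α → 𝕜} {U : Set α}
    (hint : Integrable (fun s => ∏ v, g v (s v) (s (R.par v))) (Measure.pi fun _ => μ))
    (hg : ∀ v, ∀ x ∉ U, ∀ t, g v x t = 0)
    (hF : ∀ v ≠ R.root, ∀ t ∈ U, F v t = ∫ x, g v x t * ∏ u ∈ R.children v, F u x ∂μ) :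
    ∫ s, ∏ v, g v (s v) (s (R.par v)) ∂(Measure.pi fun _ => μ) =
      ∫ x, g R.root x x * ∏ u ∈ R.children R.root, F u x ∂μ := by
  induction h : Fintype.card ι generalizing ι with
  | zero => exact ((Fintype.card_eq_zero_iff.1 h).false R.root).elim
  | succ n ih =>
    obtain hroot | ⟨v, hv⟩ := R.eq_root_or_exists_isLeaf
    · let _ : Unique ι := ⟨⟨R.root⟩, hroot⟩
      rw [R.children_eq_empty fun u hu => absurd (hroot u) hu,
        ← (measurePreserving_funUnique_of_fintype μ).integral_comp
          (MeasurableEquiv.funUnique ι α).measurableEmbedding]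
      refine integral_congr_ae (Eventually.of_forall fun s => ?_)
      simp only [Fintype.prod_unique, hroot (R.par _), Finset.prod_empty, mul_one]
      rfl
    · have hFv : EqOn (fun t => ∫ x, g v x t ∂μ) (F v) U := fun t ht => by
        simp only [hF v hv.1 t ht, R.children_eq_empty fun u _ => hv.2 u, Finset.prod_empty,
          mul_one]
      have hint' := R.integrable_prod_eraseWeight μ hv hint
      rw [R.integral_prod_of_isLeaf μ hv hint]
      simp only [R.prod_eraseWeight_congr hv hg hFv] at hint' ⊢
      rw [ih (R.erase hv) (F := fun i => F i) hint']
      · exact integral_congr_ae (Eventually.of_forall fun x =>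
          R.eraseWeight_mul_prod hv g F _ x x)
      · intro i x hx t
        rw [eraseWeight, hg i x hx, zero_mul]
      · intro i hi t ht
        simp only [R.eraseWeight_mul_prod hv g F i]
        exact hF i (fun h => hi (Subtype.ext h)) t ht
      · simp [Fintype.card_subtype_compl, h]

end Bochner

end RootedSystem

/-! ### Logarithmic forms along a path -/

section Path

theorem isBigO_principal_of_isCompact {X E F : Type*} [TopologicalSpace X] [Norm E]
    [SeminormedAddCommGroup F] {f : X → E} {g : X → F} {s K : Set X} (hK : IsCompact K)
    (hs : s ⊆ K) (h : ∀ x ∈ K, f =O[𝓝[s] x] g) : f =O[𝓟 s] g := by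
  suffices f =O[𝓟 (K ∩ s)] g by rwa [inter_eq_right.2 hs] at this
  refine hK.induction_on (p := fun A => f =O[𝓟 (A ∩ s)] g) (by simp) ?_ ?_ ?_
  · exact fun A B hAB hB => hB.mono (principal_mono.2 (inter_subset_inter_left s hAB))
  · intro A B hA hB
    rw [union_inter_distrib_right, ← sup_principal]
    exact hA.sup hB
  · intro x hx
    obtain ⟨C, hC⟩ := (h x hx).bound
    refine ⟨_, mem_nhdsWithin_of_mem_nhds (eventually_nhdsWithin_iff.1 hC), ?_⟩
    exact IsBigO.of_bound C (eventually_principal.2 fun y hy => hy.1 hy.2)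

theorem exists_Ioo_forall_eq_of_mem (S : Finset ℝ) (t : ℝ) :
    ∃ l < t, ∃ u > t, ∀ s ∈ S, s ∈ Ioo l u → s = t := by
  have hnhds : ((S.erase t : Finset ℝ) : Set ℝ)ᶜ ∈ 𝓝 t :=
    (S.erase t).finite_toSet.isClosed.isOpen_compl.mem_nhds (by simp)
  obtain ⟨l, u, ht, hsub⟩ := mem_nhds_iff_exists_Ioo_subset.1 hnhds
  refine ⟨l, ht.1, u, ht.2, fun s hs hsI => ?_⟩
  by_contra hne
  exact hsub hsI (Finset.mem_coe.2 (Finset.mem_erase.2 ⟨hne, hs⟩))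

theorem measurable_indicator_of_continuousOn {E : Type*} [TopologicalSpace E]
    [MeasurableSpace E] [BorelSpace E] [Zero E] {f : ℝ → E} {s : Set ℝ} (hs : MeasurableSet s)
    (h : ContinuousOn f s) : Measurable (s.indicator f) := by
  classical
  rw [← piecewise_eq_indicator]
  exact h.measurable_piecewise continuousOn_const hs

variable {γ : ℝ → ℂ}

theorem isBigO_deriv_of_contDiffOn {a b : ℝ} (hab : a < b) (h : ContDiffOn ℝ ∞ γ (Icc a b)) :
    deriv γ =O[𝓟 (Ioo a b)] fun _ => (1 : ℝ) := by
  have hc : ContinuousOn (derivWithin γ (Icc a b)) (Icc a b) :=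
    h.continuousOn_derivWithin (uniqueDiffOn_Icc hab) (by simp)
  obtain ⟨C, hC⟩ := isCompact_Icc.exists_bound_of_continuousOn hc
  refine IsBigO.of_bound C (eventually_principal.2 fun t ht => ?_)
  rw [← derivWithin_of_mem_nhds (Icc_mem_nhds ht.1 ht.2), norm_one, mul_one]
  exact hC t (Ioo_subset_Icc_self ht)

theorem PiecewiseSmooth.eventually_contDiffAt (h : PiecewiseSmooth γ) :
    ∀ᶠ t in cofinite, t ∈ Ioo (0 : ℝ) 1 → ContDiffAt ℝ ∞ γ t := by
  obtain ⟨-, S, hS⟩ := h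
  filter_upwards [S.eventually_cofinite_notMem] with t htS ht
  obtain ⟨l, hl, u, hu, hlu⟩ := exists_Ioo_forall_eq_of_mem S t
  have hl' : max l 0 < t := max_lt hl ht.1
  have hu' : t < min u 1 := lt_min hu ht.2
  refine (hS _ _ (le_max_right l 0) (hl'.trans hu') (min_le_right u 1) fun s hs hsI => ?_)
    |>.contDiffAt (Icc_mem_nhds hl' hu')
  exact htS (hlu s hs (Ioo_subset_Ioo (le_max_left _ _) (min_le_left _ _) hsI) ▸ hs)

theorem PiecewiseSmooth.isBigO_deriv_nhdsGT (h : PiecewiseSmooth γ) {t : ℝ}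
    (ht : t ∈ Ico (0 : ℝ) 1) : deriv γ =O[𝓝[>] t] fun _ => (1 : ℝ) := by
  obtain ⟨-, S, hS⟩ := h
  obtain ⟨l, hl, u, hu, hlu⟩ := exists_Ioo_forall_eq_of_mem S t
  have hu' : t < min u 1 := lt_min hu ht.2
  refine (isBigO_deriv_of_contDiffOn hu' (hS _ _ ht.1 hu' (min_le_right _ _) fun s hs hsI =>
    hsI.1.ne' (hlu s hs ⟨hl.trans hsI.1, hsI.2.trans_le (min_le_left _ _)⟩))).mono ?_
  exact le_principal_iff.2 (Ioo_mem_nhdsGT hu')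

theorem PiecewiseSmooth.isBigO_deriv_nhdsLT (h : PiecewiseSmooth γ) {t : ℝ}
    (ht : t ∈ Ioc (0 : ℝ) 1) : deriv γ =O[𝓝[<] t] fun _ => (1 : ℝ) := by
  obtain ⟨-, S, hS⟩ := h
  obtain ⟨l, hl, u, hu, hlu⟩ := exists_Ioo_forall_eq_of_mem S t
  have hl' : max l 0 < t := max_lt hl ht.1
  refine (isBigO_deriv_of_contDiffOn hl' (hS _ _ (le_max_right _ _) hl' ht.2 fun s hs hsI =>
    hsI.2.ne (hlu s hs ⟨(le_max_left _ _).trans_lt hsI.1, hsI.2.trans hu⟩))).mono ?_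
  exact le_principal_iff.2 (Ioo_mem_nhdsLT hl')

theorem PiecewiseSmooth.isBigO_deriv (h : PiecewiseSmooth γ) :
    deriv γ =O[𝓟 (Ioo 0 1)] fun _ => (1 : ℝ) := by
  refine isBigO_principal_of_isCompact isCompact_Icc Ioo_subset_Icc_self fun t ht => ?_
  have hsub : Ioo 0 1 ⊆ (Ioo 0 1 ∩ Iio t) ∪ {t} ∪ (Ioo 0 1 ∩ Ioi t) := fun s hs => by
    rcases lt_trichotomy s t with hst | hst | hst
    exacts [Or.inl (Or.inl ⟨hs, hst⟩), Or.inl (Or.inr hst), Or.inr ⟨hs, hst⟩]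
  refine IsBigO.mono ?_ (nhdsWithin_mono t hsub)
  rw [nhdsWithin_union, nhdsWithin_union]
  refine IsBigO.sup (IsBigO.sup ?_ ?_) ?_
  · rcases ht.1.eq_or_lt with rfl | h0
    · rw [Ioo_inter_Iio, Ioo_eq_empty (by simp), nhdsWithin_empty]
      exact isBigO_bot _ _
    · exact (h.isBigO_deriv_nhdsLT ⟨h0, ht.2⟩).mono (nhdsWithin_mono t inter_subset_right)
  · rw [nhdsWithin_singleton]
    exact IsBigO.of_bound ‖deriv γ t‖ (by simp)
  · rcases ht.2.eq_or_lt with rfl | h1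
    · rw [Ioo_inter_Ioi, Ioo_eq_empty (by simp), nhdsWithin_empty]
      exact isBigO_bot _ _
    · exact (h.isBigO_deriv_nhdsGT ⟨ht.1, h1⟩).mono (nhdsWithin_mono t inter_subset_right)

/-- The density of the differential form `dγ(t) / (γ(t) - a)`. -/
def form (γ : ℝ → ℂ) (a : ℂ) (t : ℝ) : ℂ := deriv γ t / (γ t - a)

namespace IsPathOn

variable {p q : TangentialBasePoint} {M : Set ℂ} (hγ : IsPathOn γ p q M) {a : ℂ}
include hγ

theorem continuousAt {t : ℝ} (ht : t ∈ Ioo (0 : ℝ) 1) : ContinuousAt γ t :=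
  hγ.piecewiseSmooth.1.continuousAt (Icc_mem_nhds ht.1 ht.2)

theorem sub_ne_zero (ha : a ∉ M) {t : ℝ} (ht : t ∈ Ioo (0 : ℝ) 1) : γ t - a ≠ 0 :=
  _root_.sub_ne_zero.2 fun h => ha (h ▸ hγ.mapsTo t ht)

theorem eventually_continuousAt_form (ha : a ∉ M) :
    ∀ᶠ t in cofinite, t ∈ Ioo (0 : ℝ) 1 → ContinuousAt (form γ a) t := by
  filter_upwards [hγ.piecewiseSmooth.eventually_contDiffAt] with t hsmooth ht
  exact ((hsmooth ht).derivWithin (m := 0) (by simp)).continuousAt.div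
    ((hγ.continuousAt ht).sub_const a) (hγ.sub_ne_zero ha ht)

theorem measurable_indicator_form (a : ℂ) : Measurable ((Ioo 0 1).indicator (form γ a)) := by
  have hγm : Measurable ((Ioo 0 1).indicator γ) := measurable_indicator_of_continuousOn
    measurableSet_Ioo (hγ.piecewiseSmooth.1.mono Ioo_subset_Icc_self)
  have heq : (Ioo 0 1).indicator (form γ a) = (Ioo 0 1).indicator fun t =>
      deriv γ t / ((Ioo 0 1).indicator γ t - a) :=
    indicator_congr fun t ht => by rw [form, indicator_of_mem ht]
  rw [heq]
  exact ((measurable_deriv γ).div (hγm.sub_const a)).indicator measurableSet_Ioo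

theorem isBigO_inv_sub_source : (fun t => (γ t - γ 0)⁻¹) =O[𝓝[>] 0] fun t : ℝ => t⁻¹ := by
  have hslope := (hγ.tangent_source.inv₀ p.vec_ne_zero).isBigO_one ℝ
  have hinv : (fun t : ℝ => (t : ℂ)⁻¹) =O[𝓝[>] 0] fun t : ℝ => t⁻¹ :=
    IsBigO.of_bound 1 (Eventually.of_forall fun t => by simp)
  refine (hslope.mul hinv).congr' ?_ (Eventually.of_forall fun t => one_mul _)
  filter_upwards [self_mem_nhdsWithin] with t (ht : 0 < t)
  rw [hγ.source, inv_div, div_mul_eq_mul_div, mul_inv_cancel₀ (by exact_mod_cast ht.ne'), one_div]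

theorem isBigO_inv_sub_target : (fun t => (γ t - γ 1)⁻¹) =O[𝓝[<] 1] fun t : ℝ => (1 - t)⁻¹ := by
  have hslope := (hγ.tangent_target.inv₀ (neg_ne_zero.2 q.vec_ne_zero)).isBigO_one ℝ
  have hinv : (fun t : ℝ => ((t : ℂ) - 1)⁻¹) =O[𝓝[<] 1] fun t : ℝ => (1 - t)⁻¹ := by
    refine IsBigO.of_bound 1 (Eventually.of_forall fun t => le_of_eq ?_)
    rw [norm_inv, norm_sub_rev, one_mul, norm_inv, ← Complex.norm_real, Complex.ofReal_sub,
      Complex.ofReal_one]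
  refine (hslope.mul hinv).congr' ?_ (Eventually.of_forall fun t => one_mul _)
  filter_upwards [self_mem_nhdsWithin] with t (ht : t < 1)
  have ht' : (t : ℂ) - 1 ≠ 0 := _root_.sub_ne_zero.2 (by exact_mod_cast ht.ne)
  rw [hγ.target, inv_div, div_mul_eq_mul_div, mul_inv_cancel₀ ht', one_div]

theorem isBigO_inv_sub (ha : a ∉ M) {g : ℝ → ℝ} (hone : (fun _ => (1 : ℝ)) =O[𝓟 (Ioo 0 1)] g)
    (hsource : a = γ 0 → (fun t => t⁻¹) =O[𝓟 (Ioo 0 1)] g)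
    (htarget : a = γ 1 → (fun t => (1 - t)⁻¹) =O[𝓟 (Ioo 0 1)] g) :
    (fun t => (γ t - a)⁻¹) =O[𝓟 (Ioo 0 1)] g := by
  refine isBigO_principal_of_isCompact isCompact_Icc Ioo_subset_Icc_self fun t ht => ?_
  have hle : 𝓝[Ioo 0 1] t ≤ 𝓟 (Ioo 0 1) := inf_le_right
  by_cases hne : γ t = a
  · have ht01 : t ∉ Ioo 0 1 := fun ht' => hγ.sub_ne_zero ha ht' (sub_eq_zero.2 hne)
    obtain rfl | h0 := ht.1.eq_or_lt
    · subst hne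
      exact (hγ.isBigO_inv_sub_source.mono (nhdsWithin_mono _ fun s hs => hs.1)).trans
        ((hsource rfl).mono hle)
    obtain rfl | h1 := ht.2.eq_or_lt
    · subst hne
      exact (hγ.isBigO_inv_sub_target.mono (nhdsWithin_mono _ fun s hs => hs.2)).trans
        ((htarget rfl).mono hle)
    · exact absurd ⟨h0, h1⟩ ht01
  · have hcont : Tendsto γ (𝓝[Ioo 0 1] t) (𝓝 (γ t)) :=
      (hγ.piecewiseSmooth.1 t ht).mono Ioo_subset_Icc_self
    exact (((hcont.sub_const a).inv₀ (_root_.sub_ne_zero.2 hne)).isBigO_one ℝ).trans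
      (hone.mono hle)

theorem isBigO_form (ha : a ∉ M) {g : ℝ → ℝ} (hone : (fun _ => (1 : ℝ)) =O[𝓟 (Ioo 0 1)] g)
    (hsource : a = γ 0 → (fun t => t⁻¹) =O[𝓟 (Ioo 0 1)] g)
    (htarget : a = γ 1 → (fun t => (1 - t)⁻¹) =O[𝓟 (Ioo 0 1)] g) :
    form γ a =O[𝓟 (Ioo 0 1)] g := by
  have h := hγ.piecewiseSmooth.isBigO_deriv.mul (hγ.isBigO_inv_sub ha hone hsource htarget)
  refine h.congr (fun t => (div_eq_mul_inv _ _).symm) (fun t => one_mul _)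

end IsPathOn

theorem IsLogAlong.hasDerivAt {L : ℝ → ℂ} (hL : IsLogAlong γ L) {t : ℝ} {γ' : ℂ}
    (ht : t ∈ Ioo (0 : ℝ) 1) (hγ : HasDerivAt γ γ' t) : HasDerivAt L (γ' / γ t) t := by
  have hγt : γ t ≠ 0 := hL.2 t ht ▸ Complex.exp_ne_zero _
  have hLt : ContinuousAt L t := hL.1.continuousAt (Ioo_mem_nhds ht.1 ht.2)
  have hlog : HasDerivAt (fun s => Complex.log (γ s / γ t)) (γ' / γ t / (γ t / γ t)) t :=
    (hγ.div_const (γ t)).clog_real (by rw [div_self hγt]; exact Complex.one_mem_slitPlane)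
  rw [div_self hγt, div_one] at hlog
  refine (hlog.const_add (L t)).congr_of_eventuallyEq ?_
  have hnear : ∀ᶠ s in 𝓝 t, ‖L s - L t‖ < Real.pi := by
    simpa only [dist_eq_norm] using Metric.tendsto_nhds.1 hLt Real.pi Real.pi_pos
  filter_upwards [hnear, Ioo_mem_nhds ht.1 ht.2] with s hs hs01
  have him := abs_lt.1 ((Complex.abs_im_le_norm _).trans_lt hs)
  rw [← hL.2 s hs01, ← hL.2 t ht, ← Complex.exp_sub, Complex.log_exp him.1 him.2.le]
  ring

theorem IsPathOn.isLogAlong_logAlong {p q : TangentialBasePoint} {M : Set ℂ}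
    (hγ : IsPathOn γ p q M) (h0 : (0 : ℂ) ∉ M) : IsLogAlong γ (logAlong γ) := by
  have hex : ∃ L, IsLogAlong γ L := by
    have : ContractibleSpace (Ioo (0 : ℝ) 1) :=
      (convex_Ioo 0 1).contractibleSpace (nonempty_Ioo.2 one_pos)
    refine Complex.exists_continuousOn_eqOn_exp_comp (inferInstance : SimplyConnectedSpace _)
      isOpen_Ioo (hγ.piecewiseSmooth.1.mono Ioo_subset_Icc_self) ?_
    rintro ⟨t, ht, h⟩
    exact h0 (h ▸ hγ.mapsTo t ht)
  rw [logAlong, dif_pos hex]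
  exact hex.choose_spec

theorem IsPathOn.eventually_hasDerivAt_log {p q : TangentialBasePoint} {M : Set ℂ}
    (hγ : IsPathOn γ p q M) (h0 : (0 : ℂ) ∉ M) :
    ∀ᶠ t in cofinite, t ∈ Ioo (0 : ℝ) 1 → HasDerivAt (logAlong γ) (form γ 0 t) t := by
  filter_upwards [hγ.piecewiseSmooth.eventually_contDiffAt] with t hsmooth ht
  have hderiv := ((hsmooth ht).differentiableAt (by simp)).hasDerivAt
  simpa only [form, sub_zero] using (hγ.isLogAlong_logAlong h0).hasDerivAt ht hderiv

end Path

/-! ### Amplitudes and densities -/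

section Weights

theorem intervalIntegrable_one_sub_rpow {r : ℝ} (hr : -1 < r) :
    IntervalIntegrable (fun x : ℝ => (1 - x) ^ r) volume 0 1 := by
  have h := (intervalIntegral.intervalIntegrable_rpow' (a := 0) (b := 1) hr).comp_sub_left 1
  rw [sub_zero, sub_self] at h
  exact h.symm

theorem hasDerivAt_rpow_mul_one_sub_rpow (α β : ℝ) {s : ℝ} (hs : s ∈ Ioo (0 : ℝ) 1) :
    HasDerivAt (fun s => s ^ α * (1 - s) ^ (-β))
      ((α * (1 - s) + β * s) * (s ^ (α - 1) * (1 - s) ^ (-β - 1))) s := by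
  have h0 : s ≠ 0 := hs.1.ne'
  have h1 : 1 - s ≠ 0 := (sub_pos.2 hs.2).ne'
  have hleft := Real.hasDerivAt_rpow_const (p := α) (Or.inl h0)
  have hright := ((hasDerivAt_id' s).const_sub 1).rpow_const (p := -β) (Or.inl h1)
  refine (hleft.mul hright).congr_deriv ?_
  rw [Real.rpow_sub_one h0, Real.rpow_sub_one h1]
  field_simp

theorem continuousOn_rpow_mul_one_sub_rpow {α : ℝ} (hα : 0 < α) (β : ℝ) :
    ContinuousOn (fun s : ℝ => s ^ α * (1 - s) ^ (-β)) (Ico 0 1) := by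
  refine (Real.continuous_rpow_const hα.le).continuousOn.mul ?_
  exact (continuousOn_const.sub continuousOn_id).rpow_const fun s hs =>
    Or.inl (sub_pos.2 hs.2).ne'

theorem min_mul_le_mul_one_sub_add {α β s : ℝ} (hs : s ∈ Ioo (0 : ℝ) 1) :
    min α β ≤ α * (1 - s) + β * s := by
  nlinarith [min_le_left α β, min_le_right α β, hs.1, hs.2]

theorem rpow_mul_one_sub_rpow_nonneg (α β : ℝ) {s : ℝ} (hs : s ∈ Ico (0 : ℝ) 1) :
    0 ≤ s ^ α * (1 - s) ^ β :=
  mul_nonneg (Real.rpow_nonneg hs.1 _) (Real.rpow_nonneg (sub_pos.2 hs.2).le _)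

variable {α β x t : ℝ}

theorem intervalIntegrable_deriv_rpow_mul_one_sub_rpow (hα : 0 < α) (hβ : 0 < β) (hx : 0 ≤ x)
    (hxt : x ≤ t) (ht : t < 1) :
    IntervalIntegrable
      (fun s => (α * (1 - s) + β * s) * (s ^ (α - 1) * (1 - s) ^ (-β - 1))) volume x t := by
  have hsub : Ioo x t ⊆ Ioo 0 1 := Ioo_subset_Ioo hx ht.le
  rw [intervalIntegrable_iff_integrableOn_Ioc_of_le hxt]
  refine intervalIntegral.integrableOn_deriv_of_nonneg
    ((continuousOn_rpow_mul_one_sub_rpow hα β).mono (Icc_subset_Ico hx ht))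
    (fun s hs => hasDerivAt_rpow_mul_one_sub_rpow α β (hsub hs)) fun s hs => ?_
  exact mul_nonneg ((lt_min hα hβ).le.trans (min_mul_le_mul_one_sub_add (hsub hs)))
    (rpow_mul_one_sub_rpow_nonneg _ _ (Ioo_subset_Ico_self (hsub hs)))

theorem intervalIntegrable_rpow_mul_one_sub_rpow (hα : 0 < α) (hβ : 0 < β) (hx : 0 ≤ x)
    (hxt : x ≤ t) (ht : t < 1) :
    IntervalIntegrable (fun s => s ^ (α - 1) * (1 - s) ^ (-β - 1)) volume x t := by
  have hsub : Ioo x t ⊆ Ioo 0 1 := Ioo_subset_Ioo hx ht.le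
  have hderiv := intervalIntegrable_deriv_rpow_mul_one_sub_rpow hα hβ hx hxt ht
  rw [intervalIntegrable_iff_integrableOn_Ioo_of_le hxt] at hderiv ⊢
  refine (hderiv.const_mul (min α β)⁻¹).mono' (by fun_prop) ?_
  refine ae_restrict_of_forall_mem measurableSet_Ioo fun s hs => ?_
  have hweight := rpow_mul_one_sub_rpow_nonneg (α - 1) (-β - 1) (Ioo_subset_Ico_self (hsub hs))
  rw [Real.norm_of_nonneg hweight, ← div_eq_inv_mul, le_div_iff₀' (lt_min hα hβ)]
  exact mul_le_mul_of_nonneg_right (min_mul_le_mul_one_sub_add (hsub hs)) hweight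

theorem integral_rpow_mul_one_sub_rpow_le (hα : 0 < α) (hβ : 0 < β) (hx : 0 ≤ x)
    (hxt : x ≤ t) (ht : t < 1) :
    ∫ s in x..t, s ^ (α - 1) * (1 - s) ^ (-β - 1) ≤ t ^ α * (1 - t) ^ (-β) / min α β := by
  have hint := intervalIntegrable_deriv_rpow_mul_one_sub_rpow hα hβ hx hxt ht
  rw [le_div_iff₀ (lt_min hα hβ), mul_comm, ← intervalIntegral.integral_const_mul]
  have hsub : Ioo x t ⊆ Ioo 0 1 := Ioo_subset_Ioo hx ht.le
  calc ∫ s in x..t, min α β * (s ^ (α - 1) * (1 - s) ^ (-β - 1))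
    _ ≤ ∫ s in x..t, (α * (1 - s) + β * s) * (s ^ (α - 1) * (1 - s) ^ (-β - 1)) :=
      intervalIntegral.integral_mono_on_of_le_Ioo hxt
        ((intervalIntegrable_rpow_mul_one_sub_rpow hα hβ hx hxt ht).const_mul _) hint fun s hs =>
        mul_le_mul_of_nonneg_right (min_mul_le_mul_one_sub_add (hsub hs))
          (rpow_mul_one_sub_rpow_nonneg _ _ (Ioo_subset_Ico_self (hsub hs)))
    _ = t ^ α * (1 - t) ^ (-β) - x ^ α * (1 - x) ^ (-β) :=
      intervalIntegral.integral_eq_sub_of_hasDerivAt_of_le hxt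
        ((continuousOn_rpow_mul_one_sub_rpow hα β).mono (Icc_subset_Ico hx ht))
        (fun s hs => hasDerivAt_rpow_mul_one_sub_rpow α β (hsub hs)) hint
    _ ≤ t ^ α * (1 - t) ^ (-β) :=
      sub_le_self _ (rpow_mul_one_sub_rpow_nonneg _ _ ⟨hx, hxt.trans_lt ht⟩)

end Weights

theorem aestronglyMeasurable_of_eventually_continuousAt {φ : ℝ → ℂ} {s : Set ℝ}
    (hs : MeasurableSet s) (h : ∀ᶠ t in cofinite, t ∈ s → ContinuousAt φ t) :
    AEStronglyMeasurable φ (volume.restrict s) := by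
  have hfin : {t | t ∈ s → ContinuousAt φ t}ᶜ.Finite := h
  rw [← Measure.restrict_congr_set (sdiff_null_ae_eq_self (hfin.measure_zero volume))]
  refine ContinuousOn.aestronglyMeasurable (fun t ht => ?_) (hs.diff hfin.measurableSet)
  exact (not_not.1 ht.2 ht.1).continuousWithinAt

theorem intervalIntegrable_of_isBigO {φ : ℝ → ℂ} {g : ℝ → ℝ} {a b : ℝ} (hab : a ≤ b)
    (hφ : ∀ᶠ t in cofinite, t ∈ Ioo a b → ContinuousAt φ t) (h : φ =O[𝓟 (Ioo a b)] g)
    (hg : IntervalIntegrable g volume a b) : IntervalIntegrable φ volume a b := by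
  rw [intervalIntegrable_iff_integrableOn_Ioo_of_le hab] at hg ⊢
  obtain ⟨C, hC⟩ := h.bound
  refine (hg.norm.const_mul C).mono'
    (aestronglyMeasurable_of_eventually_continuousAt measurableSet_Ioo hφ) ?_
  exact ae_restrict_of_forall_mem measurableSet_Ioo (eventually_principal.1 hC)

/-- The primitive of `φ` that vanishes at `0`. -/
def prim (φ : ℝ → ℂ) (t : ℝ) : ℂ := ∫ x in 0..t, φ x

theorem prim_congr {φ ψ : ℝ → ℂ} {t : ℝ} (ht : 0 ≤ t) (h : EqOn φ ψ (Ioo 0 t)) :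
    prim φ t = prim ψ t :=
  intervalIntegral.integral_congr_Ioo_of_le ht h

theorem prim_const_mul (c : ℂ) (φ : ℝ → ℂ) (t : ℝ) :
    prim (fun x => c * φ x) t = c * prim φ t :=
  intervalIntegral.integral_const_mul c φ

theorem integral_eq_sub_of_eventually_hasDerivAt {f φ : ℝ → ℂ} {a b : ℝ} (hab : a ≤ b)
    (hf : ContinuousOn f (Icc a b)) (hderiv : ∀ᶠ x in cofinite, x ∈ Ioo a b → HasDerivAt f (φ x) x)
    (hint : IntervalIntegrable φ volume a b) : ∫ x in a..b, φ x = f b - f a := by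
  have hfin : {x | x ∈ Ioo a b → HasDerivAt f (φ x) x}ᶜ.Finite := hderiv
  exact integral_eq_of_hasDerivAt_off_countable_of_le f φ hab hfin.countable hf
    (fun x hx => not_not.1 hx.2 hx.1) hint

theorem isBigO_one_sub_rpow {α β : ℝ} (h : β ≤ α) :
    (fun t : ℝ => (1 - t) ^ α) =O[𝓟 (Ico 0 1)] fun t => (1 - t) ^ β := by
  refine IsBigO.of_bound 1 (eventually_principal.2 fun t ht => ?_)
  have h0 : 0 < 1 - t := sub_pos.2 ht.2
  rw [one_mul, Real.norm_of_nonneg (Real.rpow_nonneg h0.le _),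
    Real.norm_of_nonneg (Real.rpow_nonneg h0.le _)]
  exact Real.rpow_le_rpow_of_exponent_ge h0 (sub_le_self 1 ht.1) h

theorem isBigO_id_one_Ico : (fun t : ℝ => t) =O[𝓟 (Ico 0 1)] fun _ => (1 : ℝ) :=
  IsBigO.of_bound 1 (eventually_principal.2 fun t ht => by
    simpa [abs_of_nonneg ht.1] using ht.2.le)

theorem one_sub_rpow_mul_rpow {t : ℝ} (ht : t ∈ Ico (0 : ℝ) 1) (α β : ℝ) :
    (1 - t) ^ α * (1 - t) ^ β = (1 - t) ^ (α + β) :=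
  (Real.rpow_add (sub_pos.2 ht.2) α β).symm

/-- The bounds satisfied by the functions that are integrated along the path: `φ` may have a pole
at `1` but not at `0`, up to powers of the logarithm. -/
structure IsDensity (φ : ℝ → ℂ) : Prop where
  continuousAt : ∀ᶠ t in cofinite, t ∈ Ioo (0 : ℝ) 1 → ContinuousAt φ t
  isBigO : ∀ ε : ℝ, 0 < ε → φ =O[𝓟 (Ioo 0 1)] fun x => (1 - x) ^ (-ε - 1)

/-- The bounds satisfied by the iterated integrals along the path: `f` vanishes at `0` and grows
at most like a power of the logarithm at `1`. -/
structure IsAmplitude (f : ℝ → ℂ) : Prop where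
  continuousOn : ContinuousOn f (Ico 0 1)
  isBigO : ∀ ε : ℝ, 0 < ε → f =O[𝓟 (Ico 0 1)] fun t => t * (1 - t) ^ (-ε)

namespace IsAmplitude

variable {f g : ℝ → ℂ}

theorem eventually_continuousAt (hf : IsAmplitude f) :
    ∀ᶠ t in cofinite, t ∈ Ioo (0 : ℝ) 1 → ContinuousAt f t :=
  Eventually.of_forall fun _ ht => hf.continuousOn.continuousAt (Ico_mem_nhds ht.1 ht.2)

theorem isBigO_one_sub_rpow (hf : IsAmplitude f) {ε : ℝ} (hε : 0 < ε) :
    f =O[𝓟 (Ico 0 1)] fun t => (1 - t) ^ (-ε) :=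
  (hf.isBigO ε hε).trans <| (isBigO_id_one_Ico.mul (isBigO_refl _ _)).congr_right fun _ => one_mul _

theorem apply_zero (hf : IsAmplitude f) : f 0 = 0 := by
  obtain ⟨C, hC⟩ := (hf.isBigO 1 one_pos).bound
  simpa using eventually_principal.1 hC 0 ⟨le_rfl, one_pos⟩

theorem zero : IsAmplitude fun _ => 0 where
  continuousOn := continuousOn_const
  isBigO _ _ := isBigO_zero _ _

theorem add (hf : IsAmplitude f) (hg : IsAmplitude g) : IsAmplitude fun t => f t + g t where
  continuousOn := hf.continuousOn.add hg.continuousOn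
  isBigO ε hε := (hf.isBigO ε hε).add (hg.isBigO ε hε)

theorem const_mul (hf : IsAmplitude f) (c : ℂ) : IsAmplitude fun t => c * f t where
  continuousOn := continuousOn_const.mul hf.continuousOn
  isBigO ε hε := (hf.isBigO ε hε).const_mul_left c

theorem mul (hf : IsAmplitude f) (hg : IsAmplitude g) : IsAmplitude fun t => f t * g t where
  continuousOn := hf.continuousOn.mul hg.continuousOn
  isBigO ε hε := by
    refine ((hf.isBigO _ (half_pos hε)).mul (hg.isBigO_one_sub_rpow (half_pos hε))).congr' .rfl ?_
    refine eventually_principal.2 fun t ht => ?_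
    beta_reduce
    rw [mul_assoc, one_sub_rpow_mul_rpow ht]
    ring_nf

end IsAmplitude

namespace IsDensity

variable {φ ψ f : ℝ → ℂ}

theorem add (hφ : IsDensity φ) (hψ : IsDensity ψ) : IsDensity fun x => φ x + ψ x where
  continuousAt := by
    filter_upwards [hφ.continuousAt, hψ.continuousAt] with t h1 h2 ht using (h1 ht).add (h2 ht)
  isBigO ε hε := (hφ.isBigO ε hε).add (hψ.isBigO ε hε)

theorem mul_isAmplitude (hφ : IsDensity φ) (hf : IsAmplitude f) :
    IsDensity fun x => φ x * f x where
  continuousAt := by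
    filter_upwards [hφ.continuousAt, hf.eventually_continuousAt] with t h1 h2 ht
    exact (h1 ht).mul (h2 ht)
  isBigO ε hε := by
    refine ((hφ.isBigO _ (half_pos hε)).mul ((hf.isBigO_one_sub_rpow (half_pos hε)).mono
      (principal_mono.2 Ioo_subset_Ico_self))).congr' .rfl ?_
    refine eventually_principal.2 fun t ht => ?_
    beta_reduce
    rw [one_sub_rpow_mul_rpow (Ioo_subset_Ico_self ht)]
    ring_nf

theorem intervalIntegrable (hφ : IsDensity φ) {t : ℝ} (ht : t ∈ Ico (0 : ℝ) 1) :
    IntervalIntegrable φ volume 0 t := by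
  have hsub : Ioo 0 t ⊆ Ioo 0 1 := Ioo_subset_Ioo_right ht.2.le
  refine intervalIntegrable_of_isBigO ht.1 (hφ.continuousAt.mono fun s hs hst => hs (hsub hst))
    ((hφ.isBigO 1 one_pos).mono (principal_mono.2 hsub)) ?_
  have hone := intervalIntegrable_rpow_mul_one_sub_rpow one_pos one_pos le_rfl ht.1 ht.2
  refine hone.congr fun s _ => ?_
  simp only [sub_self, Real.rpow_zero, one_mul]

theorem eventually_hasDerivAt_prim (hφ : IsDensity φ) :
    ∀ᶠ t in cofinite, t ∈ Ioo (0 : ℝ) 1 → HasDerivAt (prim φ) (φ t) t := by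
  filter_upwards [hφ.continuousAt] with t hcont ht
  exact intervalIntegral.integral_hasDerivAt_right
    (hφ.intervalIntegrable (Ioo_subset_Ico_self ht)) ⟨_, Ioo_mem_nhds ht.1 ht.2,
      aestronglyMeasurable_of_eventually_continuousAt measurableSet_Ioo hφ.continuousAt⟩ (hcont ht)

theorem isAmplitude_prim (hφ : IsDensity φ) : IsAmplitude (prim φ) where
  continuousOn := by
    intro t ht
    obtain ⟨u, htu, hu⟩ := exists_between ht.2
    have h := intervalIntegral.continuousOn_primitive_interval' (μ := volume) (a := 0)
      (hφ.intervalIntegrable ⟨ht.1.trans htu.le, hu⟩) left_mem_uIcc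
    rw [uIcc_of_le (ht.1.trans htu.le)] at h
    refine (h t ⟨ht.1, htu.le⟩).mono_of_mem_nhdsWithin ?_
    filter_upwards [self_mem_nhdsWithin, mem_nhdsWithin_of_mem_nhds (Iio_mem_nhds htu)]
      with s hs hsu using ⟨hs.1, hsu.le⟩
  isBigO ε hε := by
    obtain ⟨C, hC0, hC⟩ := (hφ.isBigO ε hε).exists_nonneg
    refine IsBigO.of_bound (C / min 1 ε) (eventually_principal.2 fun t ht => ?_)
    have hweight := intervalIntegrable_rpow_mul_one_sub_rpow one_pos hε le_rfl ht.1 ht.2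
    have hbound : ∀ x ∈ Ioc 0 t, ‖φ x‖ ≤ C * (x ^ ((1 : ℝ) - 1) * (1 - x) ^ (-ε - 1)) := by
      intro x hx
      have hx' : x ∈ Ioo (0 : ℝ) 1 := ⟨hx.1, hx.2.trans_lt ht.2⟩
      have := eventually_principal.1 hC.bound x hx'
      rw [Real.norm_of_nonneg (Real.rpow_nonneg (sub_pos.2 hx'.2).le _)] at this
      rwa [sub_self, Real.rpow_zero, one_mul]
    calc ‖prim φ t‖
      _ ≤ ∫ x in 0..t, C * (x ^ ((1 : ℝ) - 1) * (1 - x) ^ (-ε - 1)) :=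
        intervalIntegral.norm_integral_le_of_norm_le ht.1 (Eventually.of_forall hbound)
          (hweight.const_mul C)
      _ ≤ C * (t ^ (1 : ℝ) * (1 - t) ^ (-ε) / min 1 ε) := by
        rw [intervalIntegral.integral_const_mul]
        exact mul_le_mul_of_nonneg_left
          (integral_rpow_mul_one_sub_rpow_le one_pos hε le_rfl ht.1 ht.2) hC0
      _ = C / min 1 ε * ‖t * (1 - t) ^ (-ε)‖ := by
        rw [Real.norm_of_nonneg (mul_nonneg ht.1 (Real.rpow_nonneg (sub_pos.2 ht.2).le _)),
          Real.rpow_one]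
        ring

end IsDensity

theorem prim_mul_prim {φ ψ : ℝ → ℂ} (hφ : IsDensity φ) (hψ : IsDensity ψ) {t : ℝ}
    (ht : t ∈ Ico (0 : ℝ) 1) :
    prim φ t * prim ψ t = prim (fun x => φ x * prim ψ x + ψ x * prim φ x) t := by
  have hint := ((hφ.mul_isAmplitude hψ.isAmplitude_prim).add
    (hψ.mul_isAmplitude hφ.isAmplitude_prim)).intervalIntegrable ht
  have hprod := hφ.isAmplitude_prim.mul hψ.isAmplitude_prim
  refine Eq.symm ((integral_eq_sub_of_eventually_hasDerivAt ht.1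
    (hprod.continuousOn.mono (Icc_subset_Ico_right ht.2)) ?_ hint).trans ?_)
  swap; · rw [hprod.apply_zero, sub_zero]
  filter_upwards [hφ.eventually_hasDerivAt_prim, hψ.eventually_hasDerivAt_prim] with x h1 h2 hx
  have hx' : x ∈ Ioo (0 : ℝ) 1 := ⟨hx.1, hx.2.trans ht.2⟩
  refine ((h1 hx').mul (h2 hx')).congr_deriv ?_
  ring

theorem div_mul_one_sub_rpow {x t : ℝ} (hx : 0 < x) (ht : t ∈ Ioo (0 : ℝ) 1) (ε : ℝ) :
    (t / (x * (1 - t))) ^ ε = t ^ ε * (1 - t) ^ (-ε) * x ^ (-ε) := by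
  have h1 : 0 < 1 - t := sub_pos.2 ht.2
  rw [Real.div_rpow ht.1.le (mul_pos hx h1).le, Real.mul_rpow hx.le h1.le, Real.rpow_neg hx.le,
    Real.rpow_neg h1.le]
  field_simp

theorem one_le_div_mul_one_sub {x t : ℝ} (hx : 0 < x) (hxt : x ≤ t) (ht : t < 1) :
    1 ≤ t / (x * (1 - t)) := by
  rw [one_le_div (mul_pos hx (sub_pos.2 ht))]
  nlinarith

section Convolution

variable {t ε : ℝ}

theorem div_mul_one_sub_rpow_mul_one_sub_rpow (ht : t ∈ Ioo (0 : ℝ) 1) {x : ℝ} (hx : 0 < x) :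
    (t / (x * (1 - t))) ^ ε * (1 - x) ^ (-ε - 1) =
      t ^ ε * (1 - t) ^ (-ε) * (x ^ (1 - ε - 1) * (1 - x) ^ (-ε - 1)) := by
  rw [div_mul_one_sub_rpow hx ht, sub_sub_cancel_left]
  ring

theorem intervalIntegrable_div_mul_one_sub_rpow (ht : t ∈ Ioo (0 : ℝ) 1) (hε : ε ∈ Ioo (0 : ℝ) 1) :
    IntervalIntegrable (fun x => (t / (x * (1 - t))) ^ ε * (1 - x) ^ (-ε - 1)) volume 0 t := by
  refine ((intervalIntegrable_rpow_mul_one_sub_rpow (sub_pos.2 hε.2) hε.1 le_rfl ht.1.le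
    ht.2).const_mul (t ^ ε * (1 - t) ^ (-ε))).congr fun x hx => ?_
  rw [uIoc_of_le ht.1.le] at hx
  exact (div_mul_one_sub_rpow_mul_one_sub_rpow ht hx.1).symm

theorem integral_div_mul_one_sub_rpow_le (ht : t ∈ Ioo (0 : ℝ) 1) (hε : ε ∈ Ioo (0 : ℝ) 1) :
    ∫ x in 0..t, (t / (x * (1 - t))) ^ ε * (1 - x) ^ (-ε - 1) ≤
      (min (1 - ε) ε)⁻¹ * (t * (1 - t) ^ (-(2 * ε))) := by
  have h1 : 0 < 1 - t := sub_pos.2 ht.2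
  calc ∫ x in 0..t, (t / (x * (1 - t))) ^ ε * (1 - x) ^ (-ε - 1)
    _ = t ^ ε * (1 - t) ^ (-ε) * ∫ x in 0..t, x ^ (1 - ε - 1) * (1 - x) ^ (-ε - 1) := by
      rw [← intervalIntegral.integral_const_mul]
      exact intervalIntegral.integral_congr_Ioo_of_le ht.1.le fun x hx =>
        div_mul_one_sub_rpow_mul_one_sub_rpow ht hx.1
    _ ≤ t ^ ε * (1 - t) ^ (-ε) * (t ^ (1 - ε) * (1 - t) ^ (-ε) / min (1 - ε) ε) :=
      mul_le_mul_of_nonneg_left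
        (integral_rpow_mul_one_sub_rpow_le (sub_pos.2 hε.2) hε.1 le_rfl ht.1.le ht.2)
        (rpow_mul_one_sub_rpow_nonneg _ _ (Ioo_subset_Ico_self ht))
    _ = (min (1 - ε) ε)⁻¹ * (t ^ (ε + (1 - ε)) * (1 - t) ^ (-ε + -ε)) := by
      rw [Real.rpow_add ht.1, Real.rpow_add h1]
      ring
    _ = (min (1 - ε) ε)⁻¹ * (t * (1 - t) ^ (-(2 * ε))) := by
      rw [add_sub_cancel, Real.rpow_one, two_mul, neg_add]

end Convolution

theorem inv_mul_inv_one_sub_le {x s δ : ℝ} (hx : 0 < x) (hxs : x ≤ s) (hs : s < 1) (hδ : 0 ≤ δ) :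
    s⁻¹ * (1 - s)⁻¹ ≤ x ^ (-δ) * (s ^ (δ - 1) * (1 - s) ^ (-δ - 1)) := by
  have h0 : 0 < s := hx.trans_le hxs
  have h1 : 0 < 1 - s := sub_pos.2 hs
  have hone := Real.one_le_rpow (one_le_div_mul_one_sub hx hxs hs) hδ
  rw [div_mul_one_sub_rpow hx ⟨h0, hs⟩] at hone
  calc s⁻¹ * (1 - s)⁻¹
    _ ≤ s ^ δ * (1 - s) ^ (-δ) * x ^ (-δ) * (s⁻¹ * (1 - s)⁻¹) :=
      le_mul_of_one_le_left (mul_pos (inv_pos.2 h0) (inv_pos.2 h1)).le hone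
    _ = x ^ (-δ) * (s ^ (δ - 1) * (1 - s) ^ (-δ - 1)) := by
      rw [Real.rpow_sub_one h0.ne', Real.rpow_sub_one h1.ne']
      ring

section Log

variable {γ : ℝ → ℂ} {p q : TangentialBasePoint} {M : Set ℂ}

namespace IsPathOn

variable (hγ : IsPathOn γ p q M)
include hγ

theorem isBigO_form_inv_mul_inv {a : ℂ} (ha : a ∉ M) :
    form γ a =O[𝓟 (Ioo 0 1)] fun t => t⁻¹ * (1 - t)⁻¹ := by
  have hle : ∀ f : ℝ → ℝ, (∀ t ∈ Ioo (0 : ℝ) 1, 0 ≤ f t ∧ f t ≤ t⁻¹ * (1 - t)⁻¹) →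
      f =O[𝓟 (Ioo 0 1)] fun t => t⁻¹ * (1 - t)⁻¹ := fun f hf =>
    IsBigO.of_norm_eventuallyLE <| eventually_principal.2 fun t ht =>
      (Real.norm_of_nonneg (hf t ht).1).trans_le (hf t ht).2
  have hinv : ∀ t ∈ Ioo (0 : ℝ) 1, 1 ≤ t⁻¹ ∧ 1 ≤ (1 - t)⁻¹ := fun t ht =>
    ⟨(one_le_inv₀ ht.1).2 ht.2.le, (one_le_inv₀ (sub_pos.2 ht.2)).2 (sub_le_self 1 ht.1.le)⟩
  refine hγ.isBigO_form ha (hle _ fun t ht => ?_) (fun _ => hle _ fun t ht => ?_)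
    (fun _ => hle _ fun t ht => ?_) <;> obtain ⟨h0, h1⟩ := hinv t ht
  · exact ⟨zero_le_one, one_le_mul_of_one_le_of_one_le h0 h1⟩
  · exact ⟨zero_le_one.trans h0, le_mul_of_one_le_right (zero_le_one.trans h0) h1⟩
  · exact ⟨zero_le_one.trans h1, le_mul_of_one_le_left (zero_le_one.trans h1) h0⟩

theorem isDensity_form {a : ℂ} (ha : a ∉ M) (hsource : a ≠ γ 0) : IsDensity (form γ a) where
  continuousAt := hγ.eventually_continuousAt_form ha
  isBigO ε hε := by
    have hle : Ioo (0 : ℝ) 1 ⊆ Ico 0 1 := Ioo_subset_Ico_self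
    refine hγ.isBigO_form ha ?_ (fun h => absurd h hsource) fun _ => ?_
    · refine ((isBigO_one_sub_rpow (by linarith : -ε - 1 ≤ 0)).mono
        (principal_mono.2 hle)).congr_left fun t => Real.rpow_zero _
    · refine ((isBigO_one_sub_rpow (by linarith : -ε - 1 ≤ -1)).mono
        (principal_mono.2 hle)).congr_left fun t => Real.rpow_neg_one _

theorem isDensity_form_mul {a : ℂ} (ha : a ∉ M) {f : ℝ → ℂ} (hf : IsAmplitude f) :
    IsDensity fun x => form γ a x * f x where
  continuousAt := by
    filter_upwards [hγ.eventually_continuousAt_form ha, hf.eventually_continuousAt] with t h1 h2 ht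
    exact (h1 ht).mul (h2 ht)
  isBigO ε hε := by
    refine ((hγ.isBigO_form_inv_mul_inv ha).mul ((hf.isBigO ε hε).mono
      (principal_mono.2 Ioo_subset_Ico_self))).congr' .rfl ?_
    refine eventually_principal.2 fun t ht => ?_
    have h0 : t ≠ 0 := ht.1.ne'
    beta_reduce
    rw [Real.rpow_sub_one (sub_pos.2 ht.2).ne']
    field_simp

theorem exists_norm_log_sub_le (h0 : 0 ∉ M) {δ : ℝ} (hδ : 0 < δ) :
    ∃ C, 0 ≤ C ∧ ∀ ⦃x t : ℝ⦄, 0 < x → x ≤ t → t < 1 →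
      ‖logAlong γ t - logAlong γ x‖ ≤ C * (t / (x * (1 - t))) ^ δ := by
  obtain ⟨C, hC0, hC⟩ := (hγ.isBigO_form_inv_mul_inv h0).exists_nonneg
  refine ⟨C / δ, div_nonneg hC0 hδ.le, fun x t hx hxt ht => ?_⟩
  have hsub : Ioo x t ⊆ Ioo 0 1 := Ioo_subset_Ioo hx.le ht.le
  have hbound : ∀ s ∈ Ioc x t,
      ‖form γ 0 s‖ ≤ C * x ^ (-δ) * (s ^ (δ - 1) * (1 - s) ^ (-δ - 1)) := by
    intro s hs
    have hs' : s ∈ Ioo (0 : ℝ) 1 := ⟨hx.trans hs.1, hs.2.trans_lt ht⟩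
    refine (eventually_principal.1 hC.bound s hs').trans ?_
    rw [Real.norm_of_nonneg (mul_pos (inv_pos.2 hs'.1) (inv_pos.2 (sub_pos.2 hs'.2))).le, mul_assoc]
    exact mul_le_mul_of_nonneg_left (inv_mul_inv_one_sub_le hx hs.1.le hs'.2 hδ.le) hC0
  have hweight := (intervalIntegrable_rpow_mul_one_sub_rpow hδ hδ hx.le hxt ht).const_mul
    (C * x ^ (-δ))
  have hint := intervalIntegrable_of_isBigO hxt
    ((hγ.eventually_continuousAt_form h0).mono fun s hs hsxt => hs (hsub hsxt))
    (IsBigO.of_norm_eventuallyLE (eventually_principal.2 fun s hs =>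
      hbound s (Ioo_subset_Ioc_self hs))) hweight
  rw [← integral_eq_sub_of_eventually_hasDerivAt hxt
    ((hγ.isLogAlong_logAlong h0).1.mono (Icc_subset_Ioo hx ht))
    ((hγ.eventually_hasDerivAt_log h0).mono fun s hs hsxt => hs (hsub hsxt)) hint]
  calc ‖∫ s in x..t, form γ 0 s‖
    _ ≤ ∫ s in x..t, C * x ^ (-δ) * (s ^ (δ - 1) * (1 - s) ^ (-δ - 1)) :=
      intervalIntegral.norm_integral_le_of_norm_le hxt (Eventually.of_forall hbound) hweight
    _ ≤ C * x ^ (-δ) * (t ^ δ * (1 - t) ^ (-δ) / δ) := by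
      have hle := integral_rpow_mul_one_sub_rpow_le hδ hδ hx.le hxt ht
      rw [min_self] at hle
      rw [intervalIntegral.integral_const_mul]
      exact mul_le_mul_of_nonneg_left hle (mul_nonneg hC0 (Real.rpow_nonneg hx.le _))
    _ = C / δ * (t / (x * (1 - t))) ^ δ := by
      rw [div_mul_one_sub_rpow hx ⟨hx.trans_le hxt, ht⟩]
      ring

theorem exists_norm_log_sub_pow_le (h0 : 0 ∉ M) (k : ℕ) {ε : ℝ} (hε : 0 < ε) :
    ∃ C, 0 ≤ C ∧ ∀ ⦃x t : ℝ⦄, 0 < x → x ≤ t → t < 1 →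
      ‖logAlong γ t - logAlong γ x‖ ^ k ≤ C * (t / (x * (1 - t))) ^ ε := by
  obtain ⟨C, hC0, hC⟩ := hγ.exists_norm_log_sub_le h0 (δ := ε / (k + 1)) (by positivity)
  refine ⟨C ^ k, pow_nonneg hC0 k, fun x t hx hxt ht => ?_⟩
  have hone := one_le_div_mul_one_sub hx hxt ht
  refine (pow_le_pow_left₀ (norm_nonneg _) (hC hx hxt ht) k).trans ?_
  rw [mul_pow, ← Real.rpow_mul_natCast (zero_le_one.trans hone)]
  refine mul_le_mul_of_nonneg_left (Real.rpow_le_rpow_of_exponent_le hone ?_) (pow_nonneg hC0 k)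
  rw [div_mul_eq_mul_div, div_le_iff₀ (by positivity)]
  nlinarith

theorem intervalIntegrable_log_pow_mul (h0 : 0 ∉ M) {φ : ℝ → ℂ} (hφ : IsDensity φ) (k : ℕ)
    {t : ℝ} (ht : t ∈ Ioo (0 : ℝ) 1) :
    IntervalIntegrable (fun x => (logAlong γ t - logAlong γ x) ^ k * φ x) volume 0 t := by
  obtain ⟨C, hC0, hC⟩ := hγ.exists_norm_log_sub_pow_le h0 k one_half_pos
  have hsub : Ioo 0 t ⊆ Ioo 0 1 := Ioo_subset_Ioo_right ht.2.le
  refine intervalIntegrable_of_isBigO ht.1.le ?_ ?_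
    (intervalIntegrable_div_mul_one_sub_rpow ht ⟨one_half_pos, one_half_lt_one⟩)
  · filter_upwards [hφ.continuousAt] with x hx hxt
    have hL := (hγ.isLogAlong_logAlong h0).1.continuousAt
      (Ioo_mem_nhds (hsub hxt).1 (hsub hxt).2)
    exact ((continuousAt_const.sub hL).pow k).mul (hx (hsub hxt))
  · refine IsBigO.mul (IsBigO.of_bound C (eventually_principal.2 fun x hx => ?_))
      ((hφ.isBigO _ one_half_pos).mono (principal_mono.2 hsub))
    rw [norm_pow]
    refine (hC hx.1 hx.2.le ht.2).trans (mul_le_mul_of_nonneg_left (le_abs_self _) hC0)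

theorem exists_norm_log_pow_mul_le (h0 : 0 ∉ M) {f : ℝ → ℂ} (hf : IsAmplitude f) (k : ℕ)
    {t : ℝ} (ht : t ∈ Ioo (0 : ℝ) 1) :
    ∃ K : ℝ, ∀ x ∈ Icc 0 t, ‖(logAlong γ t - logAlong γ x) ^ k * f x‖ ≤
      K * (x ^ (1 / 2 : ℝ) * (1 - x) ^ (-1 : ℝ)) := by
  obtain ⟨C, hC0, hC⟩ := hγ.exists_norm_log_sub_pow_le h0 k one_half_pos
  obtain ⟨B, hB⟩ := (hf.isBigO 1 one_pos).bound
  refine ⟨C * (t ^ (1 / 2 : ℝ) * (1 - t) ^ (-(1 / 2) : ℝ)) * B, fun x hx => ?_⟩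
  obtain rfl | hx0 := hx.1.eq_or_lt
  · simp [hf.apply_zero]
  have hx1 : x ∈ Ico (0 : ℝ) 1 := ⟨hx.1, hx.2.trans_lt ht.2⟩
  have hfx := eventually_principal.1 hB x hx1
  rw [Real.norm_of_nonneg (mul_nonneg hx.1 (Real.rpow_nonneg (sub_pos.2 hx1.2).le _))] at hfx
  have hsqrt : x ^ (-(1 / 2) : ℝ) * x = x ^ (1 / 2 : ℝ) := by
    rw [← Real.rpow_add_one hx0.ne']
    norm_num
  calc ‖(logAlong γ t - logAlong γ x) ^ k * f x‖
    _ = ‖logAlong γ t - logAlong γ x‖ ^ k * ‖f x‖ := by rw [norm_mul, norm_pow]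
    _ ≤ C * (t / (x * (1 - t))) ^ (1 / 2 : ℝ) * (B * (x * (1 - x) ^ (-1 : ℝ))) :=
      mul_le_mul (hC hx0 hx.2 ht.2) hfx (norm_nonneg _) (mul_nonneg hC0 (Real.rpow_nonneg
        (zero_le_one.trans (one_le_div_mul_one_sub hx0 hx.2 ht.2)) _))
    _ = _ := by
      rw [div_mul_one_sub_rpow hx0 ht, ← hsqrt]
      ring

theorem continuousOn_log_pow_mul (h0 : 0 ∉ M) {f : ℝ → ℂ} (hf : IsAmplitude f) (k : ℕ)
    {t : ℝ} (ht : t ∈ Ioo (0 : ℝ) 1) :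
    ContinuousOn (fun x => (logAlong γ t - logAlong γ x) ^ k * f x) (Icc 0 t) := by
  intro x hx
  obtain rfl | hx0 := hx.1.eq_or_lt
  · obtain ⟨K, hK⟩ := hγ.exists_norm_log_pow_mul_le h0 hf k ht
    have hlim := ((continuousOn_rpow_mul_one_sub_rpow one_half_pos 1).mono
      (Icc_subset_Ico_right ht.2) 0 hx).const_mul K
    have hzero : K * ((0 : ℝ) ^ (1 / 2 : ℝ) * (1 - 0) ^ (-1 : ℝ)) = 0 := by simp
    rw [ContinuousWithinAt, hzero] at hlim
    rw [ContinuousWithinAt, hf.apply_zero, mul_zero]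
    exact squeeze_zero_norm' (eventually_nhdsWithin_of_forall hK) hlim
  · have hmem : x ∈ Ioo (0 : ℝ) 1 := ⟨hx0, hx.2.trans_lt ht.2⟩
    have hL := (hγ.isLogAlong_logAlong h0).1.continuousAt (Ioo_mem_nhds hmem.1 hmem.2)
    exact (((continuousAt_const.sub hL).pow k).mul (hf.continuousOn.continuousAt
      (Ico_mem_nhds hmem.1 hmem.2))).continuousWithinAt

theorem prim_log_pow_succ (h0 : 0 ∉ M) {φ : ℝ → ℂ} (hφ : IsDensity φ) (k : ℕ) {t : ℝ}
    (ht : t ∈ Ioo (0 : ℝ) 1) :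
    prim (fun x => (logAlong γ t - logAlong γ x) ^ (k + 1) * φ x) t =
      (k + 1) * prim (fun x => (logAlong γ t - logAlong γ x) ^ k * (form γ 0 x * prim φ x)) t := by
  have hamp := hφ.isAmplitude_prim
  have hleft := hγ.intervalIntegrable_log_pow_mul h0 hφ (k + 1) ht
  have hright := (hγ.intervalIntegrable_log_pow_mul h0 (hγ.isDensity_form_mul h0 hamp) k
    ht).const_mul (k + 1 : ℂ)
  have hsub : Ioo 0 t ⊆ Ioo 0 1 := Ioo_subset_Ioo_right ht.2.le
  rw [← prim_const_mul, ← sub_eq_zero, prim, prim,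
    ← intervalIntegral.integral_sub hleft hright, integral_eq_sub_of_eventually_hasDerivAt ht.1.le
      (hγ.continuousOn_log_pow_mul h0 hamp (k + 1) ht) ?_ (hleft.sub hright), hamp.apply_zero,
    sub_self, zero_pow k.succ_ne_zero, zero_mul, mul_zero, sub_zero]
  filter_upwards [hφ.eventually_hasDerivAt_prim, hγ.eventually_hasDerivAt_log h0]
    with x hprim hlog hx
  refine ((((hlog (hsub hx)).const_sub _).pow (k + 1)).mul (hprim (hsub hx))).congr_deriv ?_
  simp only [Pi.pow_apply, Nat.add_sub_cancel]
  push_cast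
  ring

theorem prim_log_pow_div_factorial (h0 : 0 ∉ M) {φ : ℝ → ℂ} (hφ : IsDensity φ) (k : ℕ) {t : ℝ}
    (ht : t ∈ Ioo (0 : ℝ) 1) :
    prim (fun x => (logAlong γ t - logAlong γ x) ^ k / k.factorial * φ x) t =
      (fun f => prim fun x => form γ 0 x * f x)^[k] (prim φ) t := by
  induction k generalizing φ with
  | zero => simp
  | succ k ih =>
    have hfac : ((k + 1).factorial : ℂ) = (k + 1) * k.factorial := by
      rw [Nat.factorial_succ]
      push_cast
      ring
    have hk : (k + 1 : ℂ) ≠ 0 := by exact_mod_cast k.succ_ne_zero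
    have hpull : ∀ (n : ℕ) (ψ : ℝ → ℂ),
        prim (fun x => (logAlong γ t - logAlong γ x) ^ n / n.factorial * ψ x) t =
          (n.factorial : ℂ)⁻¹ * prim (fun x => (logAlong γ t - logAlong γ x) ^ n * ψ x) t := by
      intro n ψ
      rw [← prim_const_mul]
      congr 1 with x
      ring
    rw [Function.iterate_succ_apply, ← ih (hγ.isDensity_form_mul h0 hφ.isAmplitude_prim), hpull,
      hpull, hγ.prim_log_pow_succ h0 hφ k ht, hfac]
    field_simp

end IsPathOn

end Log

/-! ### The integral of a colored system -/

section AmplitudeBound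

open scoped ENNReal NNReal

theorem exists_enorm_le_of_isBigO {α E F : Type*} [SeminormedAddCommGroup E]
    [SeminormedAddCommGroup F] {f : α → E} {g : α → F} {s : Set α} (h : f =O[𝓟 s] g) :
    ∃ C : ℝ≥0, ∀ x ∈ s, ‖f x‖ₑ ≤ C * ‖g x‖ₑ := by
  obtain ⟨C, hC⟩ := h.bound
  refine ⟨C.toNNReal, fun x hx => ?_⟩
  have hx' : ‖f x‖₊ ≤ C.toNNReal * ‖g x‖₊ := by
    rw [← NNReal.coe_le_coe, NNReal.coe_mul, coe_nnnorm, coe_nnnorm]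
    exact (eventually_principal.1 hC x hx).trans
      (mul_le_mul_of_nonneg_right (Real.le_coe_toNNReal C) (norm_nonneg _))
  simpa only [enorm_eq_nnnorm, ← ENNReal.coe_mul, ENNReal.coe_le_coe] using hx'

/-- The bound that `IsAmplitude` imposes on the size of a function, for functions with values in
`[0, ∞]` of which no continuity is known. -/
def HasAmplitudeBound (A : ℝ → ℝ≥0∞) : Prop :=
  ∀ ε : ℝ, 0 < ε → ∃ C : ℝ≥0, ∀ t ∈ Ioo (0 : ℝ) 1, A t ≤ C * ‖t * (1 - t) ^ (-ε)‖ₑ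

variable {ι : Type*} {A : ι → ℝ → ℝ≥0∞} {s : Finset ι}

theorem HasAmplitudeBound.mul {A B : ℝ → ℝ≥0∞} (hA : HasAmplitudeBound A)
    (hB : HasAmplitudeBound B) : HasAmplitudeBound fun t => A t * B t := by
  intro ε hε
  obtain ⟨C, hC⟩ := hA (ε / 2) (half_pos hε)
  obtain ⟨K, hK⟩ := hB (ε / 2) (half_pos hε)
  refine ⟨C * K, fun t ht => (mul_le_mul' (hC t ht) (hK t ht)).trans ?_⟩
  rw [mul_mul_mul_comm, ENNReal.coe_mul, ← enorm_mul]
  gcongr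
  have hsplit : t * (1 - t) ^ (-(ε / 2)) * (t * (1 - t) ^ (-(ε / 2))) =
      t * (t * (1 - t) ^ (-ε)) := by
    rw [mul_mul_mul_comm, one_sub_rpow_mul_rpow (Ioo_subset_Ico_self ht), mul_assoc, ← neg_add,
      add_halves]
  rw [hsplit, enorm_mul]
  refine mul_le_of_le_one_left' ?_
  rw [Real.enorm_of_nonneg ht.1.le]
  exact ENNReal.ofReal_le_one.2 ht.2.le

theorem HasAmplitudeBound.prod (hs : s.Nonempty) (hA : ∀ i ∈ s, HasAmplitudeBound (A i)) :
    HasAmplitudeBound fun t => ∏ i ∈ s, A i t := by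
  induction hs using Finset.Nonempty.cons_induction with
  | singleton i => simpa using hA i
  | cons i s hi _ ih =>
    simp only [Finset.prod_cons]
    exact (hA i (by simp)).mul (ih fun j hj => hA j (by simp [hj]))

theorem exists_prod_le_one_sub_rpow (hA : ∀ i ∈ s, HasAmplitudeBound (A i)) {ε : ℝ}
    (hε : 0 < ε) : ∃ C : ℝ≥0, ∀ t ∈ Ioo (0 : ℝ) 1, ∏ i ∈ s, A i t ≤ C * ‖(1 - t) ^ (-ε)‖ₑ := by
  rcases s.eq_empty_or_nonempty with rfl | hs
  · refine ⟨1, fun t ht => ?_⟩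
    rw [Finset.prod_empty, ENNReal.coe_one, one_mul,
      Real.enorm_of_nonneg (Real.rpow_nonneg (by linarith [ht.2]) _), ENNReal.one_le_ofReal]
    exact Real.one_le_rpow_of_pos_of_le_one_of_nonpos (by linarith [ht.2]) (by linarith [ht.1])
      (by linarith)
  · obtain ⟨C, hC⟩ := HasAmplitudeBound.prod hs hA ε hε
    refine ⟨C, fun t ht => (hC t ht).trans ?_⟩
    rw [enorm_mul, Real.enorm_of_nonneg ht.1.le]
    gcongr
    exact mul_le_of_le_one_left' (ENNReal.ofReal_le_one.2 ht.2.le)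

theorem IsPathOn.exists_form_mul_prod_le {γ : ℝ → ℂ} {p q : TangentialBasePoint} {M : Set ℂ}
    (hγ : IsPathOn γ p q M) {a : ℂ} (ha : a ∉ M) (hs : s = ∅ → a ≠ γ 0)
    (hA : ∀ i ∈ s, HasAmplitudeBound (A i)) {ε : ℝ} (hε : 0 < ε) :
    ∃ C : ℝ≥0, ∀ x ∈ Ioo (0 : ℝ) 1,
      ‖form γ a x‖ₑ * ∏ i ∈ s, A i x ≤ C * ‖(1 - x) ^ (-ε - 1)‖ₑ := by
  rcases s.eq_empty_or_nonempty with rfl | hne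
  · simpa only [Finset.prod_empty, mul_one] using
      exists_enorm_le_of_isBigO ((hγ.isDensity_form ha (hs rfl)).isBigO ε hε)
  · obtain ⟨K, hK⟩ := exists_enorm_le_of_isBigO (hγ.isBigO_form_inv_mul_inv ha)
    obtain ⟨C, hC⟩ := HasAmplitudeBound.prod hne hA ε hε
    refine ⟨K * C, fun x hx => (mul_le_mul' (hK x hx) (hC x hx)).trans (le_of_eq ?_)⟩
    have hcancel : x⁻¹ * (1 - x)⁻¹ * (x * (1 - x) ^ (-ε)) = (1 - x) ^ (-ε - 1) := by
      rw [Real.rpow_sub_one (by linarith [hx.2])]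
      field_simp [hx.1.ne']
    rw [mul_mul_mul_comm, ENNReal.coe_mul, ← enorm_mul, hcancel]

end AmplitudeBound

/-- A rooted system with an exponent and a color at each vertex. It encodes an iterated integral:
the vertex `v` contributes the form `dγ / (γ - color v)`, at a point below the one of its parent,
times a power of the increment of the logarithm between the two points. -/
structure ColoredSystem (ι : Type*) extends RootedSystem ι where
  color : ι → ℂ
  exponent : ι → ℕ
  exponent_root : exponent root = 0

namespace ColoredSystem

variable {ι : Type*} (R : ColoredSystem ι)

open Classical in
/-- The factor of the integrand at the vertex `v`, with the domain of integration built in: `x` is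
the variable of `v`, and `t` the one of its parent. -/
def kernel (γ : ℝ → ℂ) (v : ι) (x t : ℝ) : ℂ :=
  if x ∈ Ioo 0 1 ∧ (v = R.root ∨ t ∈ Ioo x 1) then
    (logAlong γ t - logAlong γ x) ^ R.exponent v / (R.exponent v).factorial *
      form γ (R.color v) x
  else 0

variable {R} {γ : ℝ → ℂ}

theorem kernel_root (x t : ℝ) :
    R.kernel γ R.root x t = (Ioo 0 1).indicator (form γ (R.color R.root)) x := by
  simp only [kernel, R.exponent_root, true_or, and_true, pow_zero, Nat.factorial_zero,
    Nat.cast_one, div_one, one_mul, indicator_apply]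

theorem kernel_of_ne_root {v : ι} (hv : v ≠ R.root) {t : ℝ} (ht : t ∈ Ioo (0 : ℝ) 1) (x : ℝ) :
    R.kernel γ v x t = (Ioo 0 t).indicator (fun x =>
      (logAlong γ t - logAlong γ x) ^ R.exponent v / (R.exponent v).factorial *
        form γ (R.color v) x) x := by
  classical
  rw [kernel, indicator_apply]
  refine if_congr ?_ rfl rfl
  rw [or_iff_right hv]
  exact ⟨fun h => ⟨h.1.1, h.2.1⟩, fun h => ⟨⟨h.1, h.2.trans ht.2⟩, ⟨h.2, ht.2⟩⟩⟩

theorem kernel_of_notMem (v : ι) {x : ℝ} (hx : x ∉ Ioo (0 : ℝ) 1) (t : ℝ) :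
    R.kernel γ v x t = 0 :=
  if_neg fun h => hx h.1

section Measurable

variable {p q : TangentialBasePoint} {M : Set ℂ}

open Classical in
theorem measurable_kernel (hγ : IsPathOn γ p q M) (h0 : 0 ∉ M) (v : ι) :
    Measurable fun z : ℝ × ℝ => R.kernel γ v z.1 z.2 := by
  have hL := measurable_indicator_of_continuousOn measurableSet_Ioo
    (hγ.isLogAlong_logAlong h0).1
  have hform := hγ.measurable_indicator_form (R.color v)
  have hcut : (fun z : ℝ × ℝ => R.kernel γ v z.1 z.2) = fun z =>
      if v = R.root ∨ z.2 ∈ Ioo z.1 1 then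
        ((Ioo 0 1).indicator (logAlong γ) z.2 - (Ioo 0 1).indicator (logAlong γ) z.1) ^
          R.exponent v / (R.exponent v).factorial * (Ioo 0 1).indicator (form γ (R.color v)) z.1
      else 0 := by
    funext ⟨x, t⟩
    by_cases hx : x ∈ Ioo (0 : ℝ) 1
    · by_cases hv : v = R.root
      · subst hv
        simp [kernel_root, R.exponent_root]
      · by_cases ht : t ∈ Ioo x 1
        · have ht' : t ∈ Ioo (0 : ℝ) 1 := ⟨hx.1.trans ht.1, ht.2⟩
          rw [kernel, if_pos ⟨hx, Or.inr ht⟩, if_pos (Or.inr ht), indicator_of_mem ht',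
            indicator_of_mem hx, indicator_of_mem hx]
        · rw [kernel, if_neg fun h => not_or_intro hv ht h.2, if_neg (not_or_intro hv ht)]
    · simp [kernel_of_notMem v hx, indicator_of_notMem hx]
  rw [hcut]
  refine Measurable.ite ?_ (by fun_prop) measurable_const
  exact (MeasurableSet.const _).union ((measurableSet_lt measurable_fst measurable_snd).inter
    (measurableSet_lt measurable_snd measurable_const))

end Measurable

variable [Fintype ι] [DecidableEq ι]

variable (R γ) in
/-- The conditions under which the integral of the product of the kernels converges for paths on
`M`: no form has a pole on the path, the form of the root has no pole at the ends of the path,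
and those of the leaves have none at its beginning. -/
structure IsConvergent (M : Set ℂ) : Prop where
  color_notMem : ∀ v, R.color v ∉ M
  color_root_ne_source : R.color R.root ≠ γ 0
  color_root_ne_target : R.color R.root ≠ γ 1
  color_ne_source : ∀ v ≠ R.root, R.children v = ∅ → R.color v ≠ γ 0

section Convergence

open scoped ENNReal NNReal

variable {p q : TangentialBasePoint} {M : Set ℂ}

theorem exists_kernel_mul_prod_le (hγ : IsPathOn γ p q M) (h0 : 0 ∉ M)
    (hR : R.IsConvergent γ M) {A : ι → ℝ → ℝ≥0∞} {v : ι} (hv : v ≠ R.root)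
    (hA : ∀ u ∈ R.children v, HasAmplitudeBound (A u)) {ε : ℝ} (hε : 0 < ε) :
    ∃ C : ℝ≥0, ∀ t ∈ Ioo (0 : ℝ) 1, ∀ x,
      ‖R.kernel γ v x t‖ₑ * ∏ u ∈ R.children v, A u x ≤ (Ioc 0 t).indicator (fun x =>
        C * ‖(t / (x * (1 - t))) ^ ε * (1 - x) ^ (-ε - 1)‖ₑ) x := by
  obtain ⟨C, hC⟩ := hγ.exists_form_mul_prod_le (hR.color_notMem v) (hR.color_ne_source v hv) hA hε
  obtain ⟨K, hK0, hK⟩ := hγ.exists_norm_log_sub_pow_le h0 (R.exponent v) hε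
  refine ⟨K.toNNReal * C, fun t ht x => ?_⟩
  by_cases hx : x ∈ Ioo 0 t
  · have hlog : ‖(logAlong γ t - logAlong γ x) ^ R.exponent v / (R.exponent v).factorial‖ₑ ≤
        K.toNNReal * ‖(t / (x * (1 - t))) ^ ε‖ₑ := by
      have hfac : (1 : ℝ) ≤ (R.exponent v).factorial := by
        exact_mod_cast (R.exponent v).factorial_pos
      have hbase : 0 ≤ t / (x * (1 - t)) :=
        div_nonneg ht.1.le (mul_nonneg hx.1.le (sub_nonneg.2 ht.2.le))
      rw [Real.enorm_of_nonneg (Real.rpow_nonneg hbase ε), ← ofReal_norm, ← ENNReal.ofReal,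
        ← ENNReal.ofReal_mul hK0, norm_div, Complex.norm_natCast, norm_pow]
      exact ENNReal.ofReal_le_ofReal
        ((div_le_self (by positivity) hfac).trans (hK hx.1 hx.2.le ht.2))
    rw [kernel_of_ne_root hv ht, indicator_of_mem hx, indicator_of_mem (Ioo_subset_Ioc_self hx),
      enorm_mul, mul_assoc, ENNReal.coe_mul, enorm_mul, mul_mul_mul_comm]
    exact mul_le_mul' hlog (hC x ⟨hx.1, hx.2.trans ht.2⟩)
  · rw [kernel_of_ne_root hv ht, indicator_of_notMem hx, enorm_zero, zero_mul]
    exact zero_le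

theorem hasAmplitudeBound_lintegral_kernel (hγ : IsPathOn γ p q M) (h0 : 0 ∉ M)
    (hR : R.IsConvergent γ M) {A : ι → ℝ → ℝ≥0∞} {v : ι} (hv : v ≠ R.root)
    (hA : ∀ u ∈ R.children v, HasAmplitudeBound (A u)) :
    HasAmplitudeBound fun t => ∫⁻ x, ‖R.kernel γ v x t‖ₑ * ∏ u ∈ R.children v, A u x := by
  intro ε hε
  obtain ⟨δ, hδ, hδε⟩ : ∃ δ ∈ Ioo (0 : ℝ) 1, 2 * δ ≤ ε :=
    ⟨min (ε / 2) (1 / 2), ⟨by positivity, (min_le_right _ _).trans_lt one_half_lt_one⟩,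
      by linarith [min_le_left (ε / 2) (1 / 2)]⟩
  obtain ⟨C, hC⟩ := exists_kernel_mul_prod_le hγ h0 hR hv hA hδ.1
  obtain ⟨K, hK⟩ : ∃ K : ℝ, K = (min (1 - δ) δ)⁻¹ := ⟨_, rfl⟩
  have hK0 : 0 ≤ K := hK ▸ inv_nonneg.2 (le_min (by linarith [hδ.2]) hδ.1.le)
  refine ⟨C * K.toNNReal, fun t ht => (lintegral_mono (hC t ht)).trans ?_⟩
  have hint := (intervalIntegrable_div_mul_one_sub_rpow ht hδ).1
  rw [lintegral_indicator measurableSet_Ioc, lintegral_const_mul' _ _ ENNReal.coe_ne_top,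
    ENNReal.coe_mul, mul_assoc, ← ofReal_integral_norm_eq_lintegral_enorm hint]
  gcongr
  have hnorm : ∫ x in Ioc 0 t, ‖(t / (x * (1 - t))) ^ δ * (1 - x) ^ (-δ - 1)‖ =
      ∫ x in 0..t, (t / (x * (1 - t))) ^ δ * (1 - x) ^ (-δ - 1) := by
    rw [intervalIntegral.integral_of_le ht.1.le]
    refine setIntegral_congr_fun measurableSet_Ioc fun x hx => Real.norm_of_nonneg ?_
    have ht' : 0 ≤ 1 - t := sub_nonneg.2 ht.2.le
    have hx' : 0 ≤ 1 - x := by linarith [hx.2]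
    have := ht.1.le
    have := hx.1.le
    positivity
  have hpow : t * (1 - t) ^ (-(2 * δ)) ≤ t * (1 - t) ^ (-ε) :=
    mul_le_mul_of_nonneg_left (Real.rpow_le_rpow_of_exponent_ge (sub_pos.2 ht.2)
      (by linarith [ht.1]) (by linarith)) ht.1.le
  rw [hnorm, Real.enorm_of_nonneg (mul_nonneg ht.1.le (Real.rpow_nonneg (sub_nonneg.2 ht.2.le) _)),
    ← ENNReal.ofReal, ← ENNReal.ofReal_mul hK0]
  exact ENNReal.ofReal_le_ofReal ((integral_div_mul_one_sub_rpow_le ht hδ).trans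
    (hK ▸ mul_le_mul_of_nonneg_left hpow hK0))

theorem lintegral_kernel_root_lt_top (hγ : IsPathOn γ p q M) (hR : R.IsConvergent γ M)
    {A : ι → ℝ → ℝ≥0∞} (hA : ∀ u ∈ R.children R.root, HasAmplitudeBound (A u)) :
    ∫⁻ x, ‖R.kernel γ R.root x x‖ₑ * ∏ u ∈ R.children R.root, A u x < ⊤ := by
  obtain ⟨K, hK⟩ := exists_enorm_le_of_isBigO (hγ.isBigO_form (hR.color_notMem R.root)
    (isBigO_refl (fun _ : ℝ => (1 : ℝ)) _) (fun h => absurd h hR.color_root_ne_source)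
    (fun h => absurd h hR.color_root_ne_target))
  obtain ⟨C, hC⟩ := exists_prod_le_one_sub_rpow hA one_half_pos
  have hint : IntegrableOn (fun x : ℝ => (1 - x) ^ (-(1 / 2) : ℝ)) (Ioo 0 1) :=
    (intervalIntegrable_one_sub_rpow (by norm_num)).1.mono_set Ioo_subset_Ioc_self
  have hle : ∀ x, ‖R.kernel γ R.root x x‖ₑ * ∏ u ∈ R.children R.root, A u x ≤
      (Ioo 0 1).indicator (fun x : ℝ => (K * C : ℝ≥0) * ‖(1 - x) ^ (-(1 / 2) : ℝ)‖ₑ) x := by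
    intro x
    by_cases hx : x ∈ Ioo (0 : ℝ) 1
    · rw [kernel_root, indicator_of_mem hx, indicator_of_mem hx, ENNReal.coe_mul, mul_assoc]
      refine (mul_le_mul' (hK x hx) (hC x hx)).trans ?_
      rw [enorm_one, mul_one]
    · rw [kernel_root, indicator_of_notMem hx, enorm_zero, zero_mul]
      exact zero_le
  refine (lintegral_mono hle).trans_lt ?_
  rw [lintegral_indicator measurableSet_Ioo, lintegral_const_mul' _ _ ENNReal.coe_ne_top]
  exact ENNReal.mul_lt_top ENNReal.coe_lt_top hint.2

theorem integrable_prod_kernel (hγ : IsPathOn γ p q M) (h0 : 0 ∉ M) (hR : R.IsConvergent γ M) :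
    Integrable fun s : ι → ℝ => ∏ v, R.kernel γ v (s v) (s (R.par v)) := by
  have hmeas := fun v => measurable_kernel (R := R) hγ h0 v
  have hbound : ∀ v, v ≠ R.root →
      HasAmplitudeBound (R.lintegralBelow volume (fun v x t => ‖R.kernel γ v x t‖ₑ) v) := by
    intro v
    induction v using R.induction_children with
    | h v ih =>
      intro hv
      simp only [funext (R.lintegralBelow_eq volume (fun v x t => ‖R.kernel γ v x t‖ₑ) v)]
      exact hasAmplitudeBound_lintegral_kernel hγ h0 hR hv fun u hu =>
        ih u hu (R.mem_children.1 hu).1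
  refine ⟨(Finset.measurable_prod _ fun v _ => (hmeas v).comp
    (by fun_prop : Measurable fun s : ι → ℝ => (s v, s (R.par v)))).aestronglyMeasurable, ?_⟩
  have henorm : ∀ s : ι → ℝ, ‖∏ v, R.kernel γ v (s v) (s (R.par v))‖ₑ =
      ∏ v, ‖R.kernel γ v (s v) (s (R.par v))‖ₑ := fun s => by
    simp only [enorm_eq_nnnorm, nnnorm_prod, ENNReal.ofNNReal_finsetProd]
  simp only [hasFiniteIntegral_iff_enorm, henorm]
  have hsplit := R.lintegral_prod volume (fun v => (hmeas v).enorm)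
    fun v _ t => R.lintegralBelow_eq volume (fun v x t => ‖R.kernel γ v x t‖ₑ) v t
  rw [← volume_pi] at hsplit
  rw [hsplit]
  exact lintegral_kernel_root_lt_top hγ hR fun u hu => hbound u (R.mem_children.1 hu).1

end Convergence

theorem integral_prod_kernel
    (hint : Integrable fun s : ι → ℝ => ∏ v, R.kernel γ v (s v) (s (R.par v))) {F : ι → ℝ → ℂ}
    (hF : ∀ v ≠ R.root, ∀ t ∈ Ioo (0 : ℝ) 1, F v t = prim (fun x =>
      (logAlong γ t - logAlong γ x) ^ R.exponent v / (R.exponent v).factorial *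
        (form γ (R.color v) x * ∏ u ∈ R.children v, F u x)) t) :
    ∫ s : ι → ℝ, ∏ v, R.kernel γ v (s v) (s (R.par v)) =
      prim (fun x => form γ (R.color R.root) x * ∏ u ∈ R.children R.root, F u x) 1 := by
  have hprim : ∀ {t : ℝ}, 0 ≤ t → ∀ f g : ℝ → ℂ,
      ∫ x, (Ioo 0 t).indicator f x * g x = prim (fun x => f x * g x) t := fun ht f g => by
    simp_rw [← indicator_mul_left]
    rw [integral_indicator measurableSet_Ioo, prim, intervalIntegral.integral_of_le ht,
      integral_Ioc_eq_integral_Ioo]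
  rw [volume_pi] at hint ⊢
  have hF' : ∀ v ≠ R.root, ∀ t ∈ Ioo (0 : ℝ) 1,
      F v t = ∫ x, R.kernel γ v x t * ∏ u ∈ R.children v, F u x := by
    intro v hv t ht
    simp only [kernel_of_ne_root hv ht]
    rw [hprim ht.1.le, hF v hv t ht]
    simp only [mul_assoc]
  rw [R.integral_prod volume hint (fun v x hx => kernel_of_notMem v hx) hF']
  simp only [kernel_root]
  exact hprim zero_le_one _ _

end ColoredSystem

/-! ### Words and shuffles -/

section Words

/-- The word whose letters are listed from the last one to the first, as in `shuffleRev`. -/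
def wordRev (l : List ℂ) : WordAlg :=
  MonoidAlgebra.of ℚ (FreeMonoid ℂ) (FreeMonoid.ofList l.reverse)

theorem wordRev_nil : wordRev [] = 1 := map_one _

theorem wordRev_cons (a : ℂ) (l : List ℂ) : wordRev (a :: l) = wordRev l * e a := by
  rw [wordRev, wordRev, e, ← map_mul, List.reverse_cons, FreeMonoid.ofList_append,
    FreeMonoid.ofList_singleton]

theorem wordRev_eq_basis (l : List ℂ) :
    wordRev l = MonoidAlgebra.basis (FreeMonoid ℂ) ℚ (FreeMonoid.ofList l.reverse) := by
  rw [wordRev, MonoidAlgebra.basis_apply, MonoidAlgebra.of_apply]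

theorem shuffleRev_nil_left (l : List ℂ) : shuffleRev [] l = wordRev l := by
  rw [shuffleRev, wordRev]

theorem shuffleRev_nil_right (l : List ℂ) : shuffleRev l [] = wordRev l := by
  cases l <;> rw [shuffleRev, wordRev]

theorem shuffle_wordRev (l l' : List ℂ) : shuffle (wordRev l) (wordRev l') = shuffleRev l l' := by
  rw [wordRev_eq_basis, wordRev_eq_basis, shuffle, Module.Basis.constr_basis,
    Module.Basis.constr_basis, FreeMonoid.toList_ofList, FreeMonoid.toList_ofList,
    List.reverse_reverse, List.reverse_reverse]

theorem shuffle_one (x : WordAlg) : shuffle x 1 = x := by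
  suffices h : shuffle.flip 1 = LinearMap.id from LinearMap.congr_fun h x
  refine (MonoidAlgebra.basis (FreeMonoid ℂ) ℚ).ext fun u => ?_
  have hu : MonoidAlgebra.basis (FreeMonoid ℂ) ℚ u = wordRev u.toList.reverse := by
    rw [wordRev_eq_basis, List.reverse_reverse, FreeMonoid.ofList_toList]
  rw [hu, LinearMap.flip_apply, ← wordRev_nil, shuffle_wordRev, shuffleRev_nil_right,
    LinearMap.id_apply]

variable {A : Set ℂ} {z : ℂ}

variable (A z) in
/-- The non-empty words with letters in `A` whose first letter is not `z`. They are listed from the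
last letter to the first; a word that starts with `e_z` has a divergent iterated integral along a
path from `z`. -/
inductive IsAdmissible : List ℂ → Prop
  | singleton {a : ℂ} (ha : a ∈ A) (hz : a ≠ z) : IsAdmissible [a]
  | cons {a : ℂ} {l : List ℂ} (ha : a ∈ A) (hl : IsAdmissible l) : IsAdmissible (a :: l)

theorem IsAdmissible.head_mem {a : ℂ} {l : List ℂ} (h : IsAdmissible A z (a :: l)) : a ∈ A := by
  cases h <;> assumption

theorem IsAdmissible.eq_nil_or_tail {a : ℂ} {l : List ℂ} (h : IsAdmissible A z (a :: l)) :
    l = [] ∧ a ≠ z ∨ IsAdmissible A z l := by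
  cases h with
  | singleton _ hz => exact Or.inl ⟨rfl, hz⟩
  | cons _ hl => exact Or.inr hl

theorem IsAdmissible.mem {l : List ℂ} (h : IsAdmissible A z l) : ∀ a ∈ l, a ∈ A := by
  induction h with
  | singleton ha => simpa using ha
  | cons ha _ ih => exact List.forall_mem_cons.2 ⟨ha, ih⟩

theorem IsAdmissible.ne_nil {l : List ℂ} (h : IsAdmissible A z l) : l ≠ [] := by
  rintro rfl
  cases h

theorem IsAdmissible.getLast_ne {l : List ℂ} (h : IsAdmissible A z l) :
    l.getLast h.ne_nil ≠ z := by
  induction h with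
  | singleton _ hz => exact hz
  | cons _ hl ih => rwa [List.getLast_cons hl.ne_nil]

variable (A z) in
/-- The span of the admissible words. -/
def admissibleSpan : Submodule ℚ WordAlg :=
  Submodule.span ℚ (wordRev '' {l | IsAdmissible A z l})

theorem wordRev_mem_admissibleSpan {l : List ℂ} (h : IsAdmissible A z l) :
    wordRev l ∈ admissibleSpan A z :=
  Submodule.subset_span (mem_image_of_mem _ h)

theorem mul_e_mem_admissibleSpan {x : WordAlg} {a : ℂ} (ha : a ∈ A)
    (hx : x ∈ admissibleSpan A z ∨ x = 1 ∧ a ≠ z) : x * e a ∈ admissibleSpan A z := by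
  rcases hx with hx | ⟨rfl, hz⟩
  · suffices admissibleSpan A z ≤ (admissibleSpan A z).comap (LinearMap.mulRight ℚ (e a)) from
      this hx
    refine Submodule.span_le.2 ?_
    rintro - ⟨l, hl, rfl⟩
    rw [SetLike.mem_coe, Submodule.mem_comap, LinearMap.mulRight_apply, ← wordRev_cons]
    exact wordRev_mem_admissibleSpan (.cons ha hl)
  · rw [← wordRev_nil, ← wordRev_cons]
    exact wordRev_mem_admissibleSpan (.singleton ha hz)

theorem mul_e_pow_mem_admissibleSpan {x : WordAlg} (hx : x ∈ admissibleSpan A z) {a : ℂ}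
    (ha : a ∈ A) (k : ℕ) : x * e a ^ k ∈ admissibleSpan A z := by
  induction k with
  | zero => rwa [pow_zero, mul_one]
  | succ k ih =>
    rw [pow_succ, ← mul_assoc]
    exact mul_e_mem_admissibleSpan ha (Or.inl ih)

theorem shuffleRev_mem_admissibleSpan : ∀ {l l' : List ℂ}, l = [] ∨ IsAdmissible A z l →
    l' = [] ∨ IsAdmissible A z l' → l ≠ [] ∨ l' ≠ [] → shuffleRev l l' ∈ admissibleSpan A z
  | [], l', _, h', hne => by
    rw [shuffleRev_nil_left]
    exact wordRev_mem_admissibleSpan (h'.resolve_left (hne.resolve_left fun h => h rfl))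
  | a :: l, [], h, _, _ => by
    rw [shuffleRev_nil_right]
    exact wordRev_mem_admissibleSpan (h.resolve_left (List.cons_ne_nil a l))
  | a :: l, b :: l', h, h', _ => by
    have ha := h.resolve_left (List.cons_ne_nil a l)
    have hb := h'.resolve_left (List.cons_ne_nil b l')
    rw [shuffleRev]
    exact add_mem
      (mul_e_mem_admissibleSpan hb.head_mem (Or.inl (shuffleRev_mem_admissibleSpan h
        (hb.eq_nil_or_tail.imp_left And.left) (Or.inl (List.cons_ne_nil a l)))))
      (mul_e_mem_admissibleSpan ha.head_mem (Or.inl (shuffleRev_mem_admissibleSpan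
        (ha.eq_nil_or_tail.imp_left And.left) h' (Or.inr (List.cons_ne_nil b l')))))
termination_by l l' => l.length + l'.length

theorem shuffle_mem_admissibleSpan {x y : WordAlg} (hx : x ∈ admissibleSpan A z)
    (hy : y ∈ admissibleSpan A z) : shuffle x y ∈ admissibleSpan A z := by
  refine LinearMap.BilinMap.apply_apply_mem_of_mem_span _ _ _ shuffle ?_ x y hx hy
  rintro - ⟨l, hl, rfl⟩ - ⟨l', hl', rfl⟩
  rw [shuffle_wordRev]
  exact shuffleRev_mem_admissibleSpan (Or.inr hl) (Or.inr hl') (Or.inl hl.ne_nil)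

theorem shuffleList_nil : shuffleList [] = 1 := rfl

theorem shuffleList_cons (x : WordAlg) (s : List WordAlg) :
    shuffleList (x :: s) = shuffle x (shuffleList s) := rfl

theorem shuffleList_mem_admissibleSpan {s : List WordAlg} (hs : s ≠ [])
    (h : ∀ x ∈ s, x ∈ admissibleSpan A z) : shuffleList s ∈ admissibleSpan A z := by
  induction s with
  | nil => exact absurd rfl hs
  | cons x s ih =>
    obtain ⟨hx, h⟩ := List.forall_mem_cons.1 h
    rw [shuffleList_cons]
    rcases eq_or_ne s [] with rfl | hs'
    · rwa [shuffleList_nil, shuffle_one]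
    · exact shuffle_mem_admissibleSpan hx (ih hs' h)

end Words

section WordIntegral

/-- The iterated integral along `γ` from `0` to `t` of the word with the given letters, listed from
the last one to the first. -/
def listIntegral (γ : ℝ → ℂ) : List ℂ → ℝ → ℂ
  | [] => fun _ => 1
  | a :: l => prim fun x => form γ a x * listIntegral γ l x

/-- The iterated integral along `γ` from `0` to `t` as a linear map on combinations of words. -/
def wordIntegral (γ : ℝ → ℂ) (t : ℝ) : WordAlg →ₗ[ℚ] ℂ :=
  (MonoidAlgebra.basis (FreeMonoid ℂ) ℚ).constr ℚ fun u => listIntegral γ u.toList.reverse t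

theorem wordIntegral_wordRev (γ : ℝ → ℂ) (t : ℝ) (l : List ℂ) :
    wordIntegral γ t (wordRev l) = listIntegral γ l t := by
  rw [wordRev_eq_basis, wordIntegral, Module.Basis.constr_basis, FreeMonoid.toList_ofList,
    List.reverse_reverse]

theorem wordIntegral_one (γ : ℝ → ℂ) (t : ℝ) : wordIntegral γ t 1 = 1 := by
  rw [← wordRev_nil, wordIntegral_wordRev, listIntegral]

theorem wordIntegral_mul_e_of_intervalIntegrable {γ : ℝ → ℂ} {A : Set ℂ} {z a : ℂ} {t : ℝ}
    (hint : ∀ y ∈ admissibleSpan A z,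
      IntervalIntegrable (fun s => form γ a s * wordIntegral γ s y) volume 0 t)
    {x : WordAlg} (hx : x ∈ admissibleSpan A z) :
    wordIntegral γ t (x * e a) = prim (fun s => form γ a s * wordIntegral γ s x) t := by
  induction hx using Submodule.span_induction with
  | mem x h =>
    obtain ⟨l, -, rfl⟩ := h
    rw [← wordRev_cons, wordIntegral_wordRev, listIntegral]
    simp only [wordIntegral_wordRev]
  | zero => simp [prim]
  | add x y hx hy ihx ihy =>
    rw [add_mul, map_add, ihx, ihy, prim, prim, prim,
      ← intervalIntegral.integral_add (hint x hx) (hint y hy)]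
    simp only [map_add, mul_add]
  | smul c x _ ih =>
    rw [smul_mul_assoc, map_smul, ih, prim, prim, ← intervalIntegral.integral_smul]
    simp only [map_smul, mul_smul_comm]

namespace IsPathOn

variable {γ : ℝ → ℂ} {p q : TangentialBasePoint} {M : Set ℂ} (hγ : IsPathOn γ p q M)
include hγ

theorem isAmplitude_listIntegral {l : List ℂ} (hl : IsAdmissible Mᶜ (γ 0) l) :
    IsAmplitude (listIntegral γ l) := by
  induction hl with
  | singleton ha hz =>
    simpa only [listIntegral, mul_one] using (hγ.isDensity_form ha hz).isAmplitude_prim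
  | cons ha _ ih => exact (hγ.isDensity_form_mul ha ih).isAmplitude_prim

theorem isAmplitude_wordIntegral {x : WordAlg} (hx : x ∈ admissibleSpan Mᶜ (γ 0)) :
    IsAmplitude fun t => wordIntegral γ t x := by
  induction hx using Submodule.span_induction with
  | mem x h =>
    obtain ⟨l, hl, rfl⟩ := h
    simpa only [wordIntegral_wordRev] using hγ.isAmplitude_listIntegral hl
  | zero => simpa only [map_zero] using IsAmplitude.zero
  | add x y _ _ hx hy => simpa only [map_add] using hx.add hy
  | smul c x _ hx =>
    simp only [map_smul]
    simpa only [Algebra.smul_def] using hx.const_mul (algebraMap ℚ ℂ c)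

variable {x : WordAlg} {a : ℂ}

theorem isDensity_form_mul_wordIntegral (ha : a ∉ M)
    (hx : x ∈ admissibleSpan Mᶜ (γ 0) ∨ x = 1 ∧ a ≠ γ 0) :
    IsDensity fun s => form γ a s * wordIntegral γ s x := by
  rcases hx with hx | ⟨rfl, hz⟩
  · exact hγ.isDensity_form_mul ha (hγ.isAmplitude_wordIntegral hx)
  · simpa only [wordIntegral_one, mul_one] using hγ.isDensity_form ha hz

theorem wordIntegral_mul_e (ha : a ∉ M) (hx : x ∈ admissibleSpan Mᶜ (γ 0) ∨ x = 1 ∧ a ≠ γ 0)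
    {t : ℝ} (ht : t ∈ Ico (0 : ℝ) 1) :
    wordIntegral γ t (x * e a) = prim (fun s => form γ a s * wordIntegral γ s x) t := by
  rcases hx with hx | ⟨rfl, -⟩
  · exact wordIntegral_mul_e_of_intervalIntegrable (fun y hy =>
      (hγ.isDensity_form_mul_wordIntegral ha (Or.inl hy)).intervalIntegrable ht) hx
  · rw [← wordRev_nil, ← wordRev_cons, wordIntegral_wordRev, listIntegral]
    simp only [wordIntegral_wordRev]

theorem wordIntegral_mul_e_mul_e_zero_pow (h0 : 0 ∉ M) (ha : a ∉ M)
    (hx : x ∈ admissibleSpan Mᶜ (γ 0) ∨ x = 1 ∧ a ≠ γ 0) (k : ℕ) {t : ℝ}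
    (ht : t ∈ Ioo (0 : ℝ) 1) :
    wordIntegral γ t (x * e a * e 0 ^ k) =
      prim (fun s => (logAlong γ t - logAlong γ s) ^ k / k.factorial *
        (form γ a s * wordIntegral γ s x)) t := by
  rw [hγ.prim_log_pow_div_factorial h0 (hγ.isDensity_form_mul_wordIntegral ha hx) k ht]
  induction k generalizing t with
  | zero => rw [pow_zero, mul_one, hγ.wordIntegral_mul_e ha hx (Ioo_subset_Ico_self ht)]; rfl
  | succ k ih =>
    rw [pow_succ, ← mul_assoc, Function.iterate_succ_apply',
      hγ.wordIntegral_mul_e h0 (Or.inl (mul_e_pow_mem_admissibleSpan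
        (mul_e_mem_admissibleSpan ha hx) h0 k)) (Ioo_subset_Ico_self ht)]
    exact prim_congr ht.1.le fun s hs =>
      congrArg (form γ 0 s * ·) (ih ⟨hs.1, hs.2.trans ht.2⟩)

theorem isDensity_form_mul_listIntegral {l : List ℂ} (h : IsAdmissible Mᶜ (γ 0) (a :: l)) :
    IsDensity fun s => form γ a s * listIntegral γ l s := by
  rcases h.eq_nil_or_tail with ⟨rfl, hz⟩ | hl
  · simpa only [listIntegral, mul_one] using hγ.isDensity_form h.head_mem hz
  · exact hγ.isDensity_form_mul h.head_mem (hγ.isAmplitude_listIntegral hl)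

theorem wordIntegral_shuffleRev : ∀ {l l' : List ℂ}, l = [] ∨ IsAdmissible Mᶜ (γ 0) l →
    l' = [] ∨ IsAdmissible Mᶜ (γ 0) l' → ∀ t ∈ Ico (0 : ℝ) 1,
    wordIntegral γ t (shuffleRev l l') = listIntegral γ l t * listIntegral γ l' t
  | [], l', _, _, t, _ => by
    rw [shuffleRev_nil_left, wordIntegral_wordRev, listIntegral, one_mul]
  | a :: l, [], _, _, t, _ => by
    rw [shuffleRev_nil_right, wordIntegral_wordRev, listIntegral, listIntegral, mul_one]
  | a :: l, b :: l', h, h', t, ht => by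
    have ha := h.resolve_left (List.cons_ne_nil a l)
    have hb := h'.resolve_left (List.cons_ne_nil b l')
    have hl := ha.eq_nil_or_tail.imp_left And.left
    have hl' := hb.eq_nil_or_tail.imp_left And.left
    have hmem := shuffleRev_mem_admissibleSpan h hl' (Or.inl (List.cons_ne_nil a l))
    have hmem' := shuffleRev_mem_admissibleSpan hl h' (Or.inr (List.cons_ne_nil b l'))
    have hφ := hγ.isDensity_form_mul_wordIntegral hb.head_mem (Or.inl hmem)
    have hψ := hγ.isDensity_form_mul_wordIntegral ha.head_mem (Or.inl hmem')
    rw [shuffleRev, map_add, hγ.wordIntegral_mul_e hb.head_mem (Or.inl hmem) ht,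
      hγ.wordIntegral_mul_e ha.head_mem (Or.inl hmem') ht, listIntegral, listIntegral,
      prim_mul_prim (hγ.isDensity_form_mul_listIntegral ha)
        (hγ.isDensity_form_mul_listIntegral hb) ht, prim, prim,
      ← intervalIntegral.integral_add (hφ.intervalIntegrable ht) (hψ.intervalIntegrable ht)]
    refine prim_congr ht.1 fun x hx => ?_
    have hx' : x ∈ Ico (0 : ℝ) 1 := ⟨hx.1.le, hx.2.trans ht.2⟩
    rw [wordIntegral_shuffleRev h hl' x hx', wordIntegral_shuffleRev hl h' x hx', listIntegral,
      listIntegral]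
    ring
termination_by l l' => l.length + l'.length

theorem wordIntegral_shuffle {y : WordAlg} (hx : x ∈ admissibleSpan Mᶜ (γ 0))
    (hy : y ∈ admissibleSpan Mᶜ (γ 0)) {t : ℝ} (ht : t ∈ Ico (0 : ℝ) 1) :
    wordIntegral γ t (shuffle x y) = wordIntegral γ t x * wordIntegral γ t y := by
  induction hx, hy using Submodule.span_induction₂ with
  | mem_mem x y hx hy =>
    obtain ⟨l, hl, rfl⟩ := hx
    obtain ⟨l', hl', rfl⟩ := hy
    rw [shuffle_wordRev, wordIntegral_wordRev, wordIntegral_wordRev,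
      hγ.wordIntegral_shuffleRev (Or.inr hl) (Or.inr hl') t ht]
  | zero_left | zero_right => simp
  | add_left x y z _ _ _ h h' => simp only [map_add, LinearMap.add_apply, h, h', add_mul]
  | add_right x y z _ _ _ h h' => simp only [map_add, h, h', mul_add]
  | smul_left r x y _ _ h => simp only [map_smul, LinearMap.smul_apply, h, smul_mul_assoc]
  | smul_right r x y _ _ h => simp only [map_smul, h, mul_smul_comm]

theorem wordIntegral_shuffleList {s : List WordAlg}
    (hs : ∀ x ∈ s, x ∈ admissibleSpan Mᶜ (γ 0)) {t : ℝ} (ht : t ∈ Ico (0 : ℝ) 1) :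
    wordIntegral γ t (shuffleList s) = (s.map (wordIntegral γ t)).prod := by
  induction s with
  | nil => rw [shuffleList_nil, wordIntegral_one, List.map_nil, List.prod_nil]
  | cons x s ih =>
    obtain ⟨hx, hs⟩ := List.forall_mem_cons.1 hs
    rw [shuffleList_cons, List.map_cons, List.prod_cons, ← ih hs]
    rcases eq_or_ne s [] with rfl | hne
    · rw [shuffleList_nil, shuffle_one, wordIntegral_one, mul_one]
    · exact hγ.wordIntegral_shuffle hx (shuffleList_mem_admissibleSpan hne hs) ht

end IsPathOn

end WordIntegral

/-! ### Iterated integrals and their regularization -/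

section Cutoff

variable (a : ℂ) (l : List ℂ)

/-- The path whose vertices are the positions of the letters of a word, with the last letter as the
root. -/
def chain : ColoredSystem (Fin (l.length + 1)) where
  root := Fin.last _
  par := Order.succ
  depth i := l.length - i
  par_root := Fin.orderSucc_last _
  depth_par i hi := by
    obtain ⟨i, rfl⟩ := Fin.exists_castSucc_eq.2 hi
    rw [Fin.orderSucc_castSucc, Fin.val_succ, Fin.val_castSucc]
    omega
  color := (a :: l).get
  exponent _ := 0
  exponent_root := rfl

variable {a l}

theorem children_chain_zero : (chain a l).children 0 = ∅ := by
  refine Finset.eq_empty_of_forall_notMem fun u hu => ?_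
  obtain ⟨hroot, hpar⟩ := (chain a l).mem_children.1 hu
  obtain ⟨u, rfl⟩ := Fin.exists_castSucc_eq.2 hroot
  exact Fin.succ_ne_zero u ((Fin.orderSucc_castSucc u).symm.trans hpar)

theorem children_chain_succ (i : Fin l.length) : (chain a l).children i.succ = {i.castSucc} := by
  ext u
  rw [RootedSystem.mem_children, Finset.mem_singleton]
  constructor
  · rintro ⟨hroot, hpar⟩
    obtain ⟨u, rfl⟩ := Fin.exists_castSucc_eq.2 hroot
    rw [Fin.succ_injective _ ((Fin.orderSucc_castSucc u).symm.trans hpar)]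
  · rintro rfl
    exact ⟨(Fin.castSucc_lt_last i).ne, Fin.orderSucc_castSucc i⟩

variable {γ : ℝ → ℂ}

theorem measurableSet_strictMono_mem_Ioo (ι : Type*) [Preorder ι] [Countable ι] (x y : ℝ) :
    MeasurableSet {s : ι → ℝ | StrictMono s ∧ ∀ i, s i ∈ Ioo x y} := by
  have h : {s : ι → ℝ | StrictMono s ∧ ∀ i, s i ∈ Ioo x y} =
      (⋂ (i) (j) (_ : i < j), {s | s i < s j}) ∩ ⋂ i, {s | s i ∈ Ioo x y} := by
    ext s
    simp [StrictMono]
  rw [h]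
  exact (MeasurableSet.iInter fun i => .iInter fun j => .iInter fun _ =>
    measurableSet_lt (measurable_pi_apply i) (measurable_pi_apply j)).inter
      (.iInter fun i => measurable_pi_apply i measurableSet_Ioo)

theorem prod_kernel_chain (s : Fin (l.length + 1) → ℝ) :
    ∏ i, (chain a l).kernel γ i (s i) (s ((chain a l).par i)) =
      {s : Fin (l.length + 1) → ℝ | StrictMono s ∧ ∀ i, s i ∈ Ioo 0 1}.indicator
        (fun s => ∏ i, form γ ((a :: l).get i) (s i)) s := by
  by_cases hs : StrictMono s ∧ ∀ i, s i ∈ Ioo (0 : ℝ) 1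
  · rw [indicator_of_mem (by exact hs)]
    refine Finset.prod_congr rfl fun i _ => ?_
    rw [ColoredSystem.kernel, if_pos]
    · simp [chain]
    · refine ⟨hs.2 i, or_iff_not_imp_left.2 fun hi => ⟨hs.1 ?_, (hs.2 _).2⟩⟩
      exact Order.lt_succ_of_not_isMax fun h => hi h.eq_top
  · rw [indicator_of_notMem (by exact hs)]
    by_contra hne
    have hker : ∀ i, (chain a l).kernel γ i (s i) (s ((chain a l).par i)) ≠ 0 := fun i =>
      Finset.prod_ne_zero_iff.1 hne i (Finset.mem_univ i)
    have hmem : ∀ i, s i ∈ Ioo (0 : ℝ) 1 ∧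
        (i = (chain a l).root ∨ s (Order.succ i) ∈ Ioo (s i) 1) := fun i =>
      by_contra fun hi => hker i (if_neg hi)
    refine hs ⟨strictMono_of_lt_succ fun i hi => ?_, fun i => (hmem i).1⟩
    exact ((hmem i).2.resolve_left fun h => hi (h ▸ isMax_top)).1

variable {p q : TangentialBasePoint} {M : Set ℂ}

theorem isConvergent_chain (hadm : IsAdmissible Mᶜ (γ 0) (a :: l).reverse)
    (hsource : (a :: l).getLast (List.cons_ne_nil a l) ≠ γ 0)
    (htarget : (a :: l).getLast (List.cons_ne_nil a l) ≠ γ 1) : (chain a l).IsConvergent γ M := by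
  have hroot : (chain a l).color (chain a l).root = (a :: l).getLast (List.cons_ne_nil a l) := by
    simp [chain, List.getLast_eq_getElem]
  refine ⟨fun v => hadm.mem _ (List.mem_reverse.2 (List.get_mem (a :: l) v)),
    hroot ▸ hsource, hroot ▸ htarget, fun v hv hleaf => ?_⟩
  cases v using Fin.cases with
  | zero =>
    change a ≠ γ 0
    simpa using hadm.getLast_ne
  | succ i => simp [children_chain_succ] at hleaf

theorem integral_prod_kernel_chain
    (hint : Integrable fun s : Fin (l.length + 1) → ℝ =>
      ∏ i, (chain a l).kernel γ i (s i) (s ((chain a l).par i))) :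
    ∫ s : Fin (l.length + 1) → ℝ, ∏ i, (chain a l).kernel γ i (s i) (s ((chain a l).par i)) =
      listIntegral γ (a :: l).reverse 1 := by
  have htake : ∀ i : Fin (l.length + 1), ((a :: l).take (i + 1)).reverse =
      (a :: l).get i :: ((a :: l).take i).reverse := fun i => by
    rw [List.take_succ_eq_append_getElem i.2, List.reverse_append]
    rfl
  have hchildren : ∀ (i : Fin (l.length + 1)) (x : ℝ), ∏ u ∈ (chain a l).children i,
      listIntegral γ ((a :: l).take (u + 1)).reverse x =
        listIntegral γ ((a :: l).take i).reverse x := by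
    intro i x
    cases i using Fin.cases with
    | zero => simp [children_chain_zero, listIntegral]
    | succ i => simp [children_chain_succ]
  rw [ColoredSystem.integral_prod_kernel
    (F := fun i => listIntegral γ ((a :: l).take (i + 1)).reverse) hint fun i _ t _ => ?_]
  · have hroot := htake (chain a l).root
    rw [List.take_of_length_le (show (a :: l).length ≤ (chain a l).root + 1 from le_rfl)] at hroot
    simp only [hchildren, hroot, listIntegral]
    rfl
  · rw [htake, listIntegral]
    simp only [hchildren]
    simp [chain]

theorem tendsto_cutoffIntegral (hγ : IsPathOn γ p q M) (h0 : 0 ∉ M)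
    (hadm : IsAdmissible Mᶜ (γ 0) (a :: l).reverse)
    (hsource : (a :: l).getLast (List.cons_ne_nil a l) ≠ γ 0)
    (htarget : (a :: l).getLast (List.cons_ne_nil a l) ≠ γ 1) :
    Tendsto (cutoffIntegral γ (a :: l)) (𝓝[>] 0) (𝓝 (listIntegral γ (a :: l).reverse 1)) := by
  obtain ⟨Q, hQ⟩ : ∃ Q : ℝ → Set (Fin (l.length + 1) → ℝ),
      ∀ z, Q z = {s | StrictMono s ∧ ∀ i, s i ∈ Ioo z (1 - z)} := ⟨_, fun _ => rfl⟩
  have hmeas : ∀ z, MeasurableSet (Q z) := fun z =>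
    hQ z ▸ measurableSet_strictMono_mem_Ioo _ z (1 - z)
  have hint := ColoredSystem.integrable_prod_kernel hγ h0
    (isConvergent_chain hadm hsource htarget)
  rw [← integral_prod_kernel_chain hint]
  have hQ0 := hQ 0
  rw [sub_zero] at hQ0
  simp only [prod_kernel_chain, ← hQ0] at hint ⊢
  have hcover : AECover (volume.restrict (Q 0)) (𝓝[>] 0) Q := by
    refine ⟨(ae_restrict_iff' (hmeas 0)).2 (Eventually.of_forall fun s hs => ?_), hmeas⟩
    rw [hQ0] at hs
    have hev : ∀ i, ∀ᶠ z in 𝓝[>] (0 : ℝ), s i ∈ Ioo z (1 - z) := fun i => by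
      filter_upwards [Ioo_mem_nhdsGT (hs.2 i).1, Ioo_mem_nhdsGT (sub_pos.2 (hs.2 i).2)]
        with z hz hz'
      exact ⟨hz.2, by linarith [hz'.2]⟩
    filter_upwards [eventually_all.2 hev] with z hz
    exact hQ z ▸ ⟨hs.1, hz⟩
  have hlim := hcover.integral_tendsto_of_countably_generated
    ((integrable_indicator_iff (hmeas 0)).1 hint)
  rw [integral_indicator (hmeas 0)]
  refine hlim.congr' ?_
  filter_upwards [self_mem_nhdsWithin] with z hz
  have hsub : Q z ⊆ Q 0 := fun s hs => by
    rw [hQ] at hs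
    rw [hQ0]
    exact ⟨hs.1, fun i => ⟨hz.trans (hs.2 i).1, (hs.2 i).2.trans (sub_lt_self 1 hz)⟩⟩
  rw [Measure.restrict_restrict_of_subset hsub, cutoffIntegral, hQ]
  rfl

end Cutoff

section Regularization

variable {γ : ℝ → ℂ}

theorem HasRegularizedIntegral.unique {a : List ℂ} {c c' : ℂ} (h : HasRegularizedIntegral γ a c)
    (h' : HasRegularizedIntegral γ a c') : c = c' := by
  obtain ⟨P, hP, rfl⟩ := h
  obtain ⟨Q, hQ, rfl⟩ := h'
  have hdiff : Tendsto (fun z : ℝ => (P - Q).eval (Real.log z : ℂ)) (𝓝[>] 0) (𝓝 0) := by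
    simpa using hQ.sub hP
  have hlog : Tendsto (fun z : ℝ => ‖(Real.log z : ℂ)‖) (𝓝[>] 0) atTop := by
    simp only [Complex.norm_real]
    exact tendsto_abs_atBot_atTop.comp Real.tendsto_log_nhdsGT_zero
  have hconst : (P - Q).degree ≤ 0 := not_lt.1 fun hdeg =>
    not_tendsto_nhds_of_tendsto_atTop ((P - Q).tendsto_norm_atTop hdeg hlog) _ hdiff.norm
  rw [Polynomial.eq_C_of_degree_le_zero hconst] at hdiff
  simp only [Polynomial.eval_C] at hdiff
  rw [← sub_eq_zero, ← Polynomial.coeff_sub]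
  exact tendsto_nhds_unique tendsto_const_nhds hdiff

theorem HasRegularizedIntegral.regularizedWord_eq {a : List ℂ} {c : ℂ}
    (h : HasRegularizedIntegral γ a c) : regularizedWord γ a = c := by
  have hex : ∃ c, HasRegularizedIntegral γ a c := ⟨c, h⟩
  rw [regularizedWord, dif_pos hex]
  exact hex.choose_spec.unique h

theorem hasRegularizedIntegral_of_tendsto {a : List ℂ} {c : ℂ}
    (h : Tendsto (cutoffIntegral γ a) (𝓝[>] 0) (𝓝 c)) : HasRegularizedIntegral γ a c :=
  ⟨Polynomial.C c, by simpa using h.sub_const c, Polynomial.coeff_C_zero⟩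

variable {p q : TangentialBasePoint} {M : Set ℂ} (hγ : IsPathOn γ p q M)
include hγ

namespace IsPathOn

variable {c : ℂ}

theorem hasRegularizedIntegral_reverse (h0 : 0 ∉ M) {l : List ℂ}
    (hadm : IsAdmissible Mᶜ (γ 0) (c :: l)) (hsource : c ≠ γ 0) (htarget : c ≠ γ 1) :
    HasRegularizedIntegral γ (c :: l).reverse (listIntegral γ (c :: l) 1) := by
  have hlast : ∀ h, (c :: l).reverse.getLast h = c := fun h => by
    rw [List.getLast_reverse, List.head_cons]
  rw [← List.reverse_reverse (c :: l)] at hadm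
  conv_rhs => rw [← List.reverse_reverse (c :: l)]
  obtain ⟨b, m, hbm⟩ := List.exists_cons_of_ne_nil
    (List.reverse_ne_nil_iff.2 (List.cons_ne_nil c l))
  simp only [hbm] at hadm hlast ⊢
  exact hasRegularizedIntegral_of_tendsto
    (tendsto_cutoffIntegral hγ h0 hadm ((hlast (List.cons_ne_nil b m)).trans_ne hsource)
      ((hlast (List.cons_ne_nil b m)).trans_ne htarget))

variable {x : WordAlg}

theorem intervalIntegrable_form_mul {a : ℂ} (ha : a ∉ M) (hsource : a ≠ γ 0)
    (htarget : a ≠ γ 1) {f : ℝ → ℂ} (hf : IsAmplitude f) :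
    IntervalIntegrable (fun t => form γ a t * f t) volume 0 1 := by
  have hpow : IntervalIntegrable (fun t : ℝ => (1 - t) ^ (-(1 / 2) : ℝ)) volume 0 1 :=
    intervalIntegrable_one_sub_rpow (by norm_num)
  have hform := hγ.isBigO_form ha (isBigO_refl (fun _ : ℝ => (1 : ℝ)) _)
    (fun h => absurd h hsource) (fun h => absurd h htarget)
  refine intervalIntegrable_of_isBigO zero_le_one (hγ.isDensity_form_mul ha hf).continuousAt ?_ hpow
  simpa using hform.mul ((hf.isBigO_one_sub_rpow one_half_pos).mono
    (principal_mono.2 Ioo_subset_Ico_self))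

theorem exists_hasRegularizedIntegral (h0 : 0 ∉ M) (hx : x ∈ admissibleSpan Mᶜ (γ 0)) (hc : c ∉ M)
    (hsource : c ≠ γ 0) (htarget : c ≠ γ 1) :
    ∀ u ∈ (x * e c).coeff.support, ∃ r, HasRegularizedIntegral γ u.toList r := by
  classical
  induction hx using Submodule.span_induction with
  | mem x hx =>
    obtain ⟨l, hl, rfl⟩ := hx
    rw [← wordRev_cons, wordRev, MonoidAlgebra.of_apply, MonoidAlgebra.coeff_single]
    intro u hu
    rw [Finset.mem_singleton.1 (Finsupp.support_single_subset hu)]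
    exact ⟨_, hγ.hasRegularizedIntegral_reverse h0 (.cons hc hl) hsource htarget⟩
  | zero => simp
  | add x y _ _ hx hy =>
    rw [add_mul, MonoidAlgebra.coeff_add]
    exact fun u hu => (Finset.mem_union.1 (Finsupp.support_add hu)).elim (hx u) (hy u)
  | smul r x _ hx =>
    rw [smul_mul_assoc, MonoidAlgebra.coeff_smul]
    exact fun u hu => hx u (Finsupp.support_smul hu)

theorem regularizedIntegral_mul_e (h0 : 0 ∉ M) (hx : x ∈ admissibleSpan Mᶜ (γ 0)) (hc : c ∉ M)
    (hsource : c ≠ γ 0) (htarget : c ≠ γ 1) :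
    regularizedIntegral γ (x * e c) = prim (fun t => form γ c t * wordIntegral γ t x) 1 := by
  have hspan : EqOn ((regularizedIntegral γ).comp (LinearMap.mulRight ℚ (e c)))
      ((wordIntegral γ 1).comp (LinearMap.mulRight ℚ (e c)))
      (wordRev '' {l | IsAdmissible Mᶜ (γ 0) l}) := by
    rintro - ⟨l, hl, rfl⟩
    rw [LinearMap.comp_apply, LinearMap.comp_apply, LinearMap.mulRight_apply, ← wordRev_cons,
      wordIntegral_wordRev, wordRev_eq_basis, regularizedIntegral, Module.Basis.constr_basis]
    exact (hγ.hasRegularizedIntegral_reverse h0 (.cons hc hl) hsource htarget).regularizedWord_eq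
  refine (LinearMap.eqOn_span hspan hx).trans (wordIntegral_mul_e_of_intervalIntegrable
    (fun y hy => hγ.intervalIntegrable_form_mul hc hsource htarget
      (hγ.isAmplitude_wordIntegral hy)) hx)

end IsPathOn

end Regularization

/-! ### Colored rooted trees -/

theorem exists_path_penultimate_eq {V : Type*} {G : SimpleGraph V} (hG : G.Connected) {r u w : V}
    (huw : G.Adj u w) (hd : G.dist r w = G.dist r u + 1) :
    ∃ P : G.Path r w, P.1.penultimate = u := by
  obtain ⟨P, hP⟩ := hG.exists_walk_length_eq_dist r u
  refine ⟨⟨P.concat huw, SimpleGraph.Walk.isPath_of_length_eq_dist _ ?_⟩, P.penultimate_concat huw⟩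
  rw [SimpleGraph.Walk.length_concat, hP, hd]

namespace ColoredTree

section Parent

variable {D : Set ℂ} {V : Type*} (X : ColoredTree D V)

theorem parent_root : X.parent X.root = X.root :=
  dif_neg (not_not.2 rfl)

theorem idx_root (k : X.Index) : X.idx k X.root = 1 :=
  dif_neg (not_not.2 rfl)

theorem parent_eq_of_adj {v w : V} (h : X.graph.Adj v w)
    (hd : X.graph.dist X.root w = X.graph.dist X.root v + 1) :
    w ≠ X.root ∧ X.parent w = v := by
  have hw : w ≠ X.root := by
    rintro rfl
    simp at hd
  obtain ⟨P, hP⟩ := exists_path_penultimate_eq X.isTree.connected h hd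
  obtain ⟨Q, hQ⟩ := exists_path_penultimate_eq X.isTree.connected (X.adj_parent hw).symm
    (X.dist_parent hw).symm
  have hPQ : P = Q := (X.isTree.isAcyclic.subsingleton_path X.root w).elim P Q
  exact ⟨hw, by rw [← hP, ← hQ, hPQ]⟩

theorem eq_parent_or_parent_eq_of_adj {v w : V} (h : X.graph.Adj v w) :
    (v ≠ X.root ∧ X.parent v = w) ∨ (w ≠ X.root ∧ X.parent w = v) :=
  (X.isTree.dist_eq_dist_add_one_of_adj X.root h).imp (X.parent_eq_of_adj h.symm)
    (X.parent_eq_of_adj h)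

/-- The rooted system of all vertices of the tree. -/
def toRootedSystem : RootedSystem V where
  root := X.root
  par := X.parent
  depth := X.graph.dist X.root
  par_root := X.parent_root
  depth_par _ hv := Nat.lt_of_succ_le (X.dist_parent hv).le

variable [Fintype V]

theorem mem_children {u v : V} : u ∈ X.children v ↔ u ≠ X.root ∧ X.parent u = v := by
  simp [children]

theorem induction_children {P : V → Prop} (h : ∀ v, (∀ u ∈ X.children v, P u) → P v) (v : V) :
    P v := by
  classical
  exact X.toRootedSystem.induction_children (fun v ih => h v fun u hu =>
    ih u (X.toRootedSystem.mem_children.2 (X.mem_children.1 hu))) v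

theorem deg_eq_one_of_children_eq_empty {v : V} (hv : v ≠ X.root) (h : X.children v = ∅) :
    X.deg v = 1 := by
  refine ncard_eq_one.2 ⟨X.parent v, Set.ext fun w => ⟨fun hw => ?_, ?_⟩⟩
  · refine ((X.eq_parent_or_parent_eq_of_adj hw).resolve_right fun hwv => ?_).2.symm
    exact Finset.notMem_empty w (h ▸ X.mem_children.2 hwv)
  · rintro rfl
    exact X.adj_parent hv

theorem children_root_nonempty (h : X.deg X.root = 1) : (X.children X.root).Nonempty := by
  obtain ⟨w, hw⟩ := ncard_eq_one.1 h
  have hadj : X.graph.Adj X.root w := hw.ge rfl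
  exact ⟨w, X.mem_children.2
    ((X.eq_parent_or_parent_eq_of_adj hadj).resolve_left fun h => h.1 rfl)⟩

end Parent

section Harvest

variable {D : Set ℂ} {V : Type*} (X : ColoredTree D V) {γ : ℝ → ℂ} {k : X.Index}

/-- The conditions on `(X; k)` under which the integral and the word of the tree agree. In contrast
to a `γ`-harvestable pair, a vertex of color `0` may have degree `2` if its index is positive. -/
structure WeaklyHarvestable (γ : ℝ → ℂ) (k : X.Index) : Prop where
  admissible : X.Admissible γ
  deg_root : X.deg X.root = 1
  deg_of_color_ne_zero : ∀ v, X.color v ≠ 0 → X.deg v ≤ 2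
  of_idx_eq_zero : ∀ v, X.idx k v = 0 → 2 < X.deg v ∧ X.color v = 0 ∧ X.color (X.parent v) ≠ 0

variable {X}

theorem Harvestable.weaklyHarvestable [Finite V] (hX : X.Harvestable γ k)
    (hk : ∀ v, X.deg v = 1 → 0 < X.idx k v) : X.WeaklyHarvestable γ k where
  admissible := hX.admissible
  deg_root := hX.deg_root
  deg_of_color_ne_zero := hX.deg_of_color_ne_zero
  of_idx_eq_zero v hv := by
    obtain ⟨hc, hpar⟩ := hX.of_idx_eq_zero v hv
    have hpos : 0 < X.deg v := (ncard_pos (toFinite _)).2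
      ⟨_, X.adj_parent (X.ne_root_of_idx_eq_zero hv.not_gt)⟩
    have hone : X.deg v ≠ 1 := fun h => (hk v h).ne' hv
    have htwo := hX.deg_of_color_eq_zero v hc
    exact ⟨by omega, hc, hpar⟩

namespace WeaklyHarvestable

variable (hX : X.WeaklyHarvestable γ k)
include hX

theorem idx_pos_of_color_ne_zero {v : V} (hv : X.color v ≠ 0) : 0 < X.idx k v :=
  Nat.pos_of_ne_zero fun h => hv (hX.of_idx_eq_zero v h).2.1

theorem idx_parent_pos {v : V} (hv : X.idx k v = 0) : 0 < X.idx k (X.parent v) :=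
  hX.idx_pos_of_color_ne_zero (hX.of_idx_eq_zero v hv).2.2

theorem idx_pos_of_idx_parent_eq_zero {v : V} (hv : X.idx k (X.parent v) = 0) : 0 < X.idx k v :=
  Nat.pos_of_ne_zero fun h => (hX.idx_parent_pos h).ne' hv

theorem color_of_two_lt_deg {v : V} (hv : 2 < X.deg v) : X.color v = 0 :=
  by_contra fun h => (hX.deg_of_color_ne_zero v h).not_gt hv

theorem color_ne_source [Fintype V] {v : V} (hv : X.children v = ∅) : X.color v ≠ γ 0 := by
  rcases eq_or_ne v X.root with rfl | hroot
  · exact hX.admissible.2.1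
  · exact fun h => (hX.admissible.1 v h).ne' (X.deg_eq_one_of_children_eq_empty hroot hv)

theorem children_nonempty [Fintype V] {v : V} (hv : X.idx k v = 0) : (X.children v).Nonempty := by
  refine Finset.nonempty_iff_ne_empty.2 fun h => ?_
  have hone := X.deg_eq_one_of_children_eq_empty (X.ne_root_of_idx_eq_zero hv.not_gt) h
  have htwo := (hX.of_idx_eq_zero v hv).1
  omega

end WeaklyHarvestable

end Harvest

section Word

variable {D : Set ℂ} {V : Type*} [Fintype V] (X : ColoredTree D V) (k : X.Index)

/-- The shuffle product of the words of the children of `v`. -/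
def childrenWord (v : V) : WordAlg :=
  shuffleList ((X.children v).attach.toList.map fun u => X.subword k u.1)

variable {X k}

theorem subword_eq (v : V) : X.subword k v = X.childrenWord k v *
    if 2 < X.deg v then e 0 ^ X.idx k v else e (X.color v) * e 0 ^ (X.idx k v - 1) := by
  rw [subword, childrenWord]

theorem childrenWord_of_children_eq_empty {v : V} (hv : X.children v = ∅) :
    X.childrenWord k v = 1 := by
  have hattach : (X.children v).attach = ∅ := Finset.attach_eq_empty_iff.2 hv
  rw [childrenWord, hattach, Finset.toList_empty, List.map_nil, shuffleList_nil]

theorem forall_mem_map_subword {v : V} {P : WordAlg → Prop}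
    (h : ∀ u ∈ X.children v, P (X.subword k u)) :
    ∀ x ∈ (X.children v).attach.toList.map fun u => X.subword k u.1, P x := by
  intro x hx
  obtain ⟨u, -, rfl⟩ := List.mem_map.1 hx
  exact h u u.2

theorem childrenWord_mem_admissibleSpan {A : Set ℂ} {z : ℂ} {v : V} (hv : (X.children v).Nonempty)
    (h : ∀ u ∈ X.children v, X.subword k u ∈ admissibleSpan A z) :
    X.childrenWord k v ∈ admissibleSpan A z :=
  shuffleList_mem_admissibleSpan (by
    rwa [ne_eq, List.map_eq_nil_iff, Finset.toList_eq_nil, Finset.attach_eq_empty_iff,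
      ← ne_eq, ← Finset.nonempty_iff_ne_empty]) (forall_mem_map_subword h)

namespace WeaklyHarvestable

variable {γ : ℝ → ℂ} (hX : X.WeaklyHarvestable γ k)
include hX

theorem subword_of_idx_eq_zero {v : V} (hv : X.idx k v = 0) :
    X.subword k v = X.childrenWord k v := by
  rw [subword_eq, if_pos (hX.of_idx_eq_zero v hv).1, hv, pow_zero, mul_one]

theorem subword_of_idx_pos {v : V} (hv : 0 < X.idx k v) :
    X.subword k v = X.childrenWord k v * e (X.color v) * e 0 ^ (X.idx k v - 1) := by
  rw [subword_eq, mul_assoc]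
  split_ifs with hd
  · rw [hX.color_of_two_lt_deg hd, ← pow_succ', Nat.sub_add_cancel hv]
  · rfl

theorem word_eq : X.word k = X.childrenWord k X.root * e (X.color X.root) := by
  have hroot := X.idx_root k
  rw [word, hX.subword_of_idx_pos (hroot ▸ one_pos), hroot, Nat.sub_self, pow_zero, mul_one]

variable {A : Set ℂ}

theorem childrenWord_mem_admissibleSpan_or {v : V}
    (h : ∀ u ∈ X.children v, X.subword k u ∈ admissibleSpan A (γ 0)) :
    X.childrenWord k v ∈ admissibleSpan A (γ 0) ∨
      X.childrenWord k v = 1 ∧ X.color v ≠ γ 0 :=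
  (X.children v).eq_empty_or_nonempty.symm.imp (childrenWord_mem_admissibleSpan · h)
    fun hv => ⟨childrenWord_of_children_eq_empty hv, hX.color_ne_source hv⟩

theorem subword_mem_admissibleSpan (hA : D ⊆ A) (h0 : 0 ∈ A) (v : V) :
    X.subword k v ∈ admissibleSpan A (γ 0) := by
  induction v using X.induction_children with
  | h v ih =>
    rcases Nat.eq_zero_or_pos (X.idx k v) with hv | hv
    · rw [hX.subword_of_idx_eq_zero hv]
      exact childrenWord_mem_admissibleSpan (hX.children_nonempty hv) ih
    · rw [hX.subword_of_idx_pos hv]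
      exact mul_e_pow_mem_admissibleSpan (mul_e_mem_admissibleSpan (hA (X.color_mem v))
        (hX.childrenWord_mem_admissibleSpan_or ih)) h0 _

theorem childrenWord_root_mem_admissibleSpan (hA : D ⊆ A) (h0 : 0 ∈ A) :
    X.childrenWord k X.root ∈ admissibleSpan A (γ 0) :=
  childrenWord_mem_admissibleSpan (X.children_root_nonempty hX.deg_root)
    fun u _ => hX.subword_mem_admissibleSpan hA h0 u

variable {p q : TangentialBasePoint} {M : Set ℂ} (hγ : IsPathOn γ p q M) (hD : D ⊆ Mᶜ)
  (h0 : 0 ∉ M)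
include hγ hD h0

theorem wordIntegral_childrenWord (v : V) {t : ℝ} (ht : t ∈ Ico (0 : ℝ) 1) :
    wordIntegral γ t (X.childrenWord k v) =
      ∏ u ∈ X.children v, wordIntegral γ t (X.subword k u) := by
  rw [childrenWord, hγ.wordIntegral_shuffleList
    (forall_mem_map_subword fun u _ => hX.subword_mem_admissibleSpan hD h0 u) ht, List.map_map]
  exact (Finset.prod_map_toList _ _).trans
    (Finset.prod_attach _ fun u => wordIntegral γ t (X.subword k u))

theorem wordIntegral_subword_of_idx_pos {v : V} (hv : 0 < X.idx k v) {t : ℝ}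
    (ht : t ∈ Ioo (0 : ℝ) 1) :
    wordIntegral γ t (X.subword k v) = prim (fun x =>
      (logAlong γ t - logAlong γ x) ^ (X.idx k v - 1) / (X.idx k v - 1).factorial *
        (form γ (X.color v) x * ∏ u ∈ X.children v, wordIntegral γ x (X.subword k u))) t := by
  rw [hX.subword_of_idx_pos hv, hγ.wordIntegral_mul_e_mul_e_zero_pow h0 (hD (X.color_mem v))
    (hX.childrenWord_mem_admissibleSpan_or fun u _ => hX.subword_mem_admissibleSpan hD h0 u) _ ht]
  refine prim_congr ht.1.le fun x hx => ?_
  simp only [hX.wordIntegral_childrenWord hγ hD h0 v ⟨hx.1.le, hx.2.trans ht.2⟩]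

theorem exists_hasRegularizedIntegral :
    ∀ u ∈ (X.word k).coeff.support, ∃ c, HasRegularizedIntegral γ u.toList c := by
  rw [hX.word_eq]
  exact hγ.exists_hasRegularizedIntegral h0 (hX.childrenWord_root_mem_admissibleSpan hD h0)
    (hD (X.color_mem _)) hX.admissible.2.1 hX.admissible.2.2

theorem regularizedIntegral_word : regularizedIntegral γ (X.word k) =
    prim (fun t => form γ (X.color X.root) t *
      ∏ u ∈ X.children X.root, wordIntegral γ t (X.subword k u)) 1 := by
  rw [hX.word_eq, hγ.regularizedIntegral_mul_e h0 (hX.childrenWord_root_mem_admissibleSpan hD h0)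
    (hD (X.color_mem _)) hX.admissible.2.1 hX.admissible.2.2]
  refine prim_congr zero_le_one fun t ht => ?_
  simp only [hX.wordIntegral_childrenWord hγ hD h0 _ (Ioo_subset_Ico_self ht)]

end WeaklyHarvestable

end Word

end ColoredTree

/-! ### The variables of a tree -/

namespace ColoredTree

section FreeSystem

variable {D : Set ℂ} {V : Type*} (X : ColoredTree D V) (k : X.Index)

variable {k} in
theorem rep_of_idx_pos {v : V} (h : 0 < X.idx k v) : X.rep k v = ⟨v, h⟩ := by
  rw [rep, dif_pos h]

variable {k} in
theorem rep_of_idx_eq_zero {v : V} (h : X.idx k v = 0) : X.rep k v = X.rep k (X.parent v) := by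
  rw [rep, dif_neg h.not_gt]

theorem dist_rep_le (v : V) : X.graph.dist X.root (X.rep k v) ≤ X.graph.dist X.root v := by
  induction v using (measure (X.graph.dist X.root)).wf.induction with
  | h v ih =>
    rcases Nat.eq_zero_or_pos (X.idx k v) with hv | hv
    · have hlt : X.graph.dist X.root (X.parent v) < X.graph.dist X.root v :=
        Nat.lt_of_succ_le (X.dist_parent (X.ne_root_of_idx_eq_zero hv.not_gt)).le
      rw [X.rep_of_idx_eq_zero hv]
      exact (ih _ hlt).trans hlt.le
    · rw [X.rep_of_idx_pos hv]

/-- The vertices that carry integration variables. The parent of `v` is the vertex whose variable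
bounds the variable of `v` on `Δ(X; k)`. -/
def freeSystem : ColoredSystem (X.Free k) where
  root := ⟨X.root, (X.idx_root k).symm ▸ one_pos⟩
  par v := X.rep k (X.parent v)
  depth v := X.graph.dist X.root v
  par_root := by
    rw [X.parent_root]
    exact X.rep_of_idx_pos _
  depth_par v hv := (X.dist_rep_le k _).trans_lt
    (Nat.lt_of_succ_le (X.dist_parent fun h => hv (Subtype.ext h)).le)
  color v := X.color v
  exponent v := X.idx k v - 1
  exponent_root := by rw [X.idx_root]

variable {X k}

theorem eq_freeSystem_root_iff {v : X.Free k} : v = (X.freeSystem k).root ↔ v.1 = X.root :=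
  Subtype.ext_iff

theorem mem_freeDomain_iff {s : X.Free k → ℝ} : s ∈ X.freeDomain k ↔
    (∀ v, s v ∈ Icc (0 : ℝ) 1) ∧
      ∀ v ≠ (X.freeSystem k).root, s v < s ((X.freeSystem k).par v) := by
  have hrep : ∀ v : X.Free k, X.extend k s v = s v := fun v =>
    congrArg s (X.rep_of_idx_pos v.2)
  constructor
  · rintro ⟨hmem, hlt⟩
    refine ⟨fun v => hrep v ▸ hmem v, fun v hv => ?_⟩
    have h := (hlt v (mt eq_freeSystem_root_iff.2 hv)).1 v.2
    rwa [hrep] at h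
  · rintro ⟨hmem, hlt⟩
    refine ⟨fun v => hmem _, fun v hv => ⟨fun hpos => ?_, fun hzero => ?_⟩⟩
    · exact (hrep ⟨v, hpos⟩).trans_lt (hlt ⟨v, hpos⟩ (mt eq_freeSystem_root_iff.1 hv))
    · exact congrArg s (X.rep_of_idx_eq_zero hzero)

theorem measurableSet_freeDomain [Countable V] : MeasurableSet (X.freeDomain k) := by
  have h : X.freeDomain k = (⋂ v, {s : X.Free k → ℝ | s v ∈ Icc (0 : ℝ) 1}) ∩
      ⋂ (v) (_ : v ≠ (X.freeSystem k).root), {s | s v < s ((X.freeSystem k).par v)} := by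
    ext s
    simp only [mem_freeDomain_iff, mem_inter_iff, mem_iInter, mem_ofPred_eq]
  rw [h]
  exact (MeasurableSet.iInter fun v => measurable_pi_apply v measurableSet_Icc).inter
    (.iInter fun v => .iInter fun _ =>
      measurableSet_lt (measurable_pi_apply _) (measurable_pi_apply _))

section Integrand

variable [Fintype (X.Free k)] {γ : ℝ → ℂ}

theorem mem_freeDomain_of_prod_kernel_ne_zero {s : X.Free k → ℝ}
    (hs : ∏ v, (X.freeSystem k).kernel γ v (s v) (s ((X.freeSystem k).par v)) ≠ 0) :
    s ∈ X.freeDomain k := by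
  have hsupp : ∀ v, s v ∈ Ioo 0 1 ∧
      (v = (X.freeSystem k).root ∨ s ((X.freeSystem k).par v) ∈ Ioo (s v) 1) := by
    intro v
    by_contra hv
    exact Finset.prod_ne_zero_iff.1 hs v (Finset.mem_univ v) (if_neg hv)
  exact mem_freeDomain_iff.2 ⟨fun v => Ioo_subset_Icc_self (hsupp v).1,
    fun v hv => ((hsupp v).2.resolve_left hv).1⟩

namespace WeaklyHarvestable

variable [Fintype V] {p q : TangentialBasePoint} {M : Set ℂ}
  (hX : X.WeaklyHarvestable γ k) (hγ : IsPathOn γ p q M) (h0 : 0 ∉ M)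
include hX hγ h0

theorem integrand_eq_prod_kernel {s : X.Free k → ℝ} (hs : s ∈ X.freeDomain k)
    (hs' : ∀ v, s v ∈ Ioo (0 : ℝ) 1) : X.integrand γ k s =
      ∏ v, (X.freeSystem k).kernel γ v (s v) (s ((X.freeSystem k).par v)) := by
  have hlt := (mem_freeDomain_iff.1 hs).2
  have hbound : ∏ v : {v // ¬ 0 < X.idx k v}, X.factor γ k (X.extend k s) v = 1 := by
    refine Finset.prod_eq_one fun v _ => ?_
    have hne : γ (X.extend k s v) ≠ 0 := fun h => h0 (h ▸ hγ.mapsTo _ (hs' _))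
    rw [factor, if_neg v.2, (hX.of_idx_eq_zero v (Nat.eq_zero_of_not_pos v.2)).2.1, sub_zero,
      div_self hne]
  rw [integrand, ← Fintype.prod_subtype_mul_prod_subtype (fun v => 0 < X.idx k v), hbound,
    mul_one]
  refine Finset.prod_congr (by ext; simp) fun v _ => ?_
  rw [factor, if_pos v.2, ColoredSystem.kernel, if_pos, extend, extend, X.rep_of_idx_pos v.2, form,
    one_div_mul_eq_div]
  · rfl
  · exact ⟨hs' v, or_iff_not_imp_left.2 fun hv => ⟨hlt v hv, (hs' _).2⟩⟩

theorem indicator_integrand_ae_eq : (X.freeDomain k).indicator (X.integrand γ k) =ᵐ[volume]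
    fun s => ∏ v, (X.freeSystem k).kernel γ v (s v) (s ((X.freeSystem k).par v)) := by
  have hne : ∀ᵐ s : X.Free k → ℝ, ∀ v, s v ≠ 0 ∧ s v ≠ 1 := ae_all_iff.2 fun v =>
    (Measure.ae_eval_ne (fun _ : X.Free k => (volume : Measure ℝ)) v 0).and
      (Measure.ae_eval_ne (fun _ : X.Free k => (volume : Measure ℝ)) v 1)
  filter_upwards [hne] with s hs
  by_cases h : s ∈ X.freeDomain k
  · rw [indicator_of_mem h]
    refine hX.integrand_eq_prod_kernel hγ h0 h fun v => ?_
    have hv := (mem_freeDomain_iff.1 h).1 v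
    exact ⟨hv.1.lt_of_ne' (hs v).1, hv.2.lt_of_ne (hs v).2⟩
  · rw [indicator_of_notMem h]
    exact (not_not.1 (mt mem_freeDomain_of_prod_kernel_ne_zero h)).symm

end WeaklyHarvestable

end Integrand

theorem WeaklyHarvestable.rep_eq_iff {γ : ℝ → ℂ} (hX : X.WeaklyHarvestable γ k) {u : V}
    {v : X.Free k} : X.rep k u = v ↔ u = v ∨ X.idx k u = 0 ∧ X.parent u = v := by
  rcases Nat.eq_zero_or_pos (X.idx k u) with hu | hu
  · rw [X.rep_of_idx_eq_zero hu, X.rep_of_idx_pos (hX.idx_parent_pos hu), Subtype.ext_iff,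
      and_iff_right hu, or_iff_right]
    rintro rfl
    exact v.2.ne' hu
  · rw [X.rep_of_idx_pos hu, Subtype.ext_iff, or_iff_left]
    exact fun h => hu.ne' h.1

section Children

variable [Fintype V] [Fintype (X.Free k)] [DecidableEq (X.Free k)] {γ : ℝ → ℂ}

namespace WeaklyHarvestable

variable (hX : X.WeaklyHarvestable γ k)
include hX

theorem mem_children_freeSystem {w v : X.Free k} : w ∈ (X.freeSystem k).children v ↔
    w.1 ∈ X.children v ∨ ∃ u ∈ X.children v, X.idx k u = 0 ∧ w.1 ∈ X.children u := by
  rw [RootedSystem.mem_children, ne_eq, eq_freeSystem_root_iff]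
  change _ ∧ X.rep k (X.parent w) = v ↔ _
  rw [hX.rep_eq_iff]
  simp only [mem_children]
  constructor
  · rintro ⟨hw, hv | ⟨hzero, hv⟩⟩
    · exact Or.inl ⟨hw, hv⟩
    · exact Or.inr ⟨_, ⟨X.ne_root_of_idx_eq_zero hzero.not_gt, hv⟩, hzero, hw, rfl⟩
  · rintro (⟨hw, hv⟩ | ⟨u, ⟨-, hv⟩, hzero, hw, rfl⟩)
    · exact ⟨hw, Or.inl hv⟩
    · exact ⟨hw, Or.inr ⟨hzero, hv⟩⟩

theorem children_eq_empty_of_children_freeSystem_eq_empty {v : X.Free k}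
    (hv : (X.freeSystem k).children v = ∅) : X.children v = ∅ := by
  refine Finset.eq_empty_of_forall_notMem fun u hu => ?_
  rcases Nat.eq_zero_or_pos (X.idx k u) with hzero | hpos
  · obtain ⟨w, hw⟩ := hX.children_nonempty hzero
    have hpos : 0 < X.idx k w :=
      hX.idx_pos_of_idx_parent_eq_zero ((X.mem_children.1 hw).2.symm ▸ hzero)
    exact Finset.eq_empty_iff_forall_notMem.1 hv ⟨w, hpos⟩
      (hX.mem_children_freeSystem.2 (Or.inr ⟨u, hu, hzero, hw⟩))
  · exact Finset.eq_empty_iff_forall_notMem.1 hv ⟨u, hpos⟩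
      (hX.mem_children_freeSystem.2 (Or.inl hu))

theorem prod_children_freeSystem {N : Type*} [CommMonoid N] {f : V → N}
    (hf : ∀ u, X.idx k u = 0 → f u = ∏ w ∈ X.children u, f w) (v : X.Free k) :
    ∏ w ∈ (X.freeSystem k).children v, f w = ∏ u ∈ X.children v, f u := by
  classical
  let g : V → Finset V := fun u => if X.idx k u = 0 then X.children u else {u}
  have hg : ∀ {u w}, w ∈ g u ↔
      (X.idx k u = 0 ∧ w ∈ X.children u) ∨ (0 < X.idx k u ∧ w = u) := by
    intro u w
    by_cases hu : X.idx k u = 0 <;> simp [g, hu, Nat.pos_iff_ne_zero]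
  have hmap : ((X.freeSystem k).children v).map (.subtype _) = (X.children v).biUnion g := by
    ext w
    simp only [Finset.mem_map, Finset.mem_biUnion, Function.Embedding.subtype_apply, hg]
    constructor
    · rintro ⟨w, hw, rfl⟩
      rcases hX.mem_children_freeSystem.1 hw with hw' | ⟨u, hu, hzero, hw'⟩
      · exact ⟨w, hw', Or.inr ⟨w.2, rfl⟩⟩
      · exact ⟨u, hu, Or.inl ⟨hzero, hw'⟩⟩
    · rintro ⟨u, hu, ⟨hzero, hw⟩ | ⟨hpos, rfl⟩⟩
      · have hpos : 0 < X.idx k w :=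
          hX.idx_pos_of_idx_parent_eq_zero ((X.mem_children.1 hw).2.symm ▸ hzero)
        exact ⟨⟨w, hpos⟩, hX.mem_children_freeSystem.2 (Or.inr ⟨u, hu, hzero, hw⟩), rfl⟩
      · exact ⟨⟨w, hpos⟩, hX.mem_children_freeSystem.2 (Or.inl hu), rfl⟩
  have hdisj : (X.children v : Set V).PairwiseDisjoint g := by
    intro u hu u' hu' hne
    refine Finset.disjoint_left.2 fun w hw hw' => ?_
    have hv := v.2
    grind [mem_children]
  calc ∏ w ∈ (X.freeSystem k).children v, f w
    _ = ∏ u ∈ X.children v, ∏ w ∈ g u, f w := by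
      rw [← Finset.prod_biUnion hdisj, ← hmap, Finset.prod_map]
      rfl
    _ = ∏ u ∈ X.children v, f u := by
      refine Finset.prod_congr rfl fun u _ => ?_
      by_cases hu : X.idx k u = 0
      · rw [hf u hu]
        exact Finset.prod_congr (if_pos hu) fun _ _ => rfl
      · exact (Finset.prod_congr (if_neg hu) fun _ _ => rfl).trans (Finset.prod_singleton f u)

variable {p q : TangentialBasePoint} {M : Set ℂ}

omit [Fintype V] in
theorem isConvergent_freeSystem [Finite V] (hD : D ⊆ Mᶜ) : (X.freeSystem k).IsConvergent γ M where
  color_notMem v := hD (X.color_mem v)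
  color_root_ne_source := hX.admissible.2.1
  color_root_ne_target := hX.admissible.2.2
  color_ne_source _ _ hv :=
    have _ := Fintype.ofFinite V
    hX.color_ne_source (hX.children_eq_empty_of_children_freeSystem_eq_empty hv)

variable (hγ : IsPathOn γ p q M) (hD : D ⊆ Mᶜ) (h0 : 0 ∉ M)
include hγ hD h0

theorem prod_children_freeSystem_wordIntegral (v : X.Free k) {t : ℝ} (ht : t ∈ Ioo (0 : ℝ) 1) :
    ∏ u ∈ (X.freeSystem k).children v, wordIntegral γ t (X.subword k u) =
      ∏ u ∈ X.children v, wordIntegral γ t (X.subword k u) :=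
  hX.prod_children_freeSystem (f := fun u => wordIntegral γ t (X.subword k u))
    (fun u hu => by
      rw [hX.subword_of_idx_eq_zero hu,
        hX.wordIntegral_childrenWord hγ hD h0 u (Ioo_subset_Ico_self ht)]) v

omit [DecidableEq (X.Free k)] in
theorem integral_prod_kernel_freeSystem :
    ∫ s : X.Free k → ℝ, ∏ v, (X.freeSystem k).kernel γ v (s v) (s ((X.freeSystem k).par v)) =
      regularizedIntegral γ (X.word k) := by
  classical
  have hprod (v : X.Free k) {t : ℝ} (ht : t ∈ Ioo (0 : ℝ) 1) :=
    hX.prod_children_freeSystem_wordIntegral hγ hD h0 v ht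
  rw [ColoredSystem.integral_prod_kernel
    (ColoredSystem.integrable_prod_kernel hγ h0 (hX.isConvergent_freeSystem hD))
    (F := fun v t => wordIntegral γ t (X.subword k v)), hX.regularizedIntegral_word hγ hD h0]
  · exact prim_congr zero_le_one fun t ht => congrArg (_ * ·) (hprod _ ht)
  · intro v _ t ht
    rw [hX.wordIntegral_subword_of_idx_pos hγ hD h0 v.2 ht]
    refine prim_congr ht.1.le fun x hx => ?_
    simp only [hprod v ⟨hx.1, hx.2.trans ht.2⟩]
    rfl

end WeaklyHarvestable

end Children

end FreeSystem

end ColoredTree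

theorem mainTheorem3_general {D : Set ℂ} (h0 : 0 ∈ D) {V : Type*} [Fintype V]
    {p q : TangentialBasePoint} {γ : ℝ → ℂ} (hγ : IsPathOn γ p q Dᶜ) {X : ColoredTree D V}
    {k : X.Index} (hX : X.WeaklyHarvestable γ k) :
    X.TreeIntegrable γ k ∧
      (∀ u ∈ (X.word k).coeff.support, ∃ c, HasRegularizedIntegral γ u.toList c) ∧
      X.treeIntegral γ k = regularizedIntegral γ (X.word k) := by
  classical
  let _ : Fintype (X.Free k) := Fintype.ofFinite _
  have hD : D ⊆ Dᶜᶜ := (compl_compl D).ge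
  have h0' : 0 ∉ Dᶜ := notMem_compl_iff.2 h0
  have hkernel := hX.indicator_integrand_ae_eq hγ h0'
  have hint := ColoredSystem.integrable_prod_kernel hγ h0' (hX.isConvergent_freeSystem hD)
  refine ⟨?_, hX.exists_hasRegularizedIntegral hγ hD h0', ?_⟩
  · exact (integrable_indicator_iff ColoredTree.measurableSet_freeDomain).1
      (hint.congr hkernel.symm)
  · calc X.treeIntegral γ k
      _ = ∫ s, (X.freeDomain k).indicator (X.integrand γ k) s :=
        (integral_indicator ColoredTree.measurableSet_freeDomain).symm
      _ = ∫ s, ∏ v, (X.freeSystem k).kernel γ v (s v) (s ((X.freeSystem k).par v)) :=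
        integral_congr_ae hkernel
      _ = regularizedIntegral γ (X.word k) := hX.integral_prod_kernel_freeSystem hγ hD h0'

end TreeIntegral

end

theorem mainTheorem3 {V : Type*} [Fintype V] (D : Finset ℂ) (h0 : (0 : ℂ) ∈ D)
    (p q : TreeIntegral.TangentialBasePoint) (γ : ℝ → ℂ)
    (hγ : TreeIntegral.IsPathOn γ p q ((D : Set ℂ)ᶜ))
    (X : TreeIntegral.ColoredTree (D : Set ℂ) V) (k : X.Index)
    (hX : X.Harvestable γ k) (hk : ∀ v, X.deg v = 1 → 0 < X.idx k v) :
    X.TreeIntegrable γ k ∧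
      (∀ u ∈ (X.word k).coeff.support,
        ∃ c, TreeIntegral.HasRegularizedIntegral γ u.toList c) ∧
      X.treeIntegral γ k = TreeIntegral.regularizedIntegral γ (X.word k) :=
  TreeIntegral.mainTheorem3_general h0 hγ (hX.weaklyHarvestable hk)
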